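/- Let $k,l,n,m\ge 1$ be integers, $\delta\in(0,1)$, and let $\sigma(t)=1/(1+e^{-t})$. **Discriminators and generators.** For $\omega=(W_1,\dots,W_{k-1},w_k)$ let $D_\omega=\sigma\circ f_\omega$ with $f_\omega(x)=w_k^{\mathsf T}\,r_{k-1}(W_{k-1}r_{k-2}(\cdots r_1(W_1x)))$, $x\in\mathbb R^d$, and for $\theta=(V_1,\dots,V_l)$ let $g_\theta(z)=V_l\,s_{l-1}(V_{l-1}s_{l-2}(\cdots s_1(V_1z)))\in\mathbb R^d$; the $W_i,V_j$ are real matrices of arbitrary fixed compatible sizes and $w_k$ is a vector. The activation functions $r_i,s_j:\mathbb R\to\mathbb R$ act entrywise, are $R_i$- and $S_j$-Lipschitz, respectively, and are positively homogeneous ($r_i(ct)=c\,r_i(t)$ and $s_j(ct)=c\,s_j(t)$ for $c\ge0$). Let $\Omega$ and $\Theta$ be nonempty sets of such parameters with $\|W_i\|_F\le M_i$ $(i<k)$, $\|w_k\|_2\le M_k$ for all $\omega\in\Omega$ and $\|V_j\|_F\le N_j$ $(j\le l)$ for all $\theta\in\Theta$. **Data.** Let $P_r$ and $P_Z$ be probability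 distributions supported in $\{x:\|x\|_2\le B_x\}$ and $\{z:\|z\|_2\le B_z\}$, respectively. Let $X_1,\dots,X_n$ be i.i.d. from $P_r$ and $Z_1,\dots,Z_m$ i.i.d. from $P_Z$. Let $P_{G_\theta}$ be the law of $g_\theta(Z)$, $Z\sim P_Z$, and let $\hat P_r$, $\hat P_{G_\theta}$ be the empirical distributions of $(X_i)_{i\le n}$ and $(g_\theta(Z_j))_{j\le m}$. **Divergence.** For a class probability estimation (CPE) loss $\ell:\{0,1\}\times[0,1]\to\mathbb R$ put $\phi=-\ell(1,\cdot)$, $\psi=-\ell(0,\cdot)$ and $$d^{(\ell)}(P,Q)=\sup_{\omega\in\Omega}\Big(\mathbb E_{X\sim P}[\phi(D_\omega(X))]+\mathbb E_{X\sim Q}[\psi(D_\omega(X))]\Big)-\phi(\tfrac12)-\psi(\tfrac12).$$ Let $\hat\theta^*$ denote a minimizer of $\theta\mapsto d^{(\ell)}(\hat P_r,\hat P_{G_\theta})$ over $\Theta$. Put $$Q_x=M_k\prod_{i=1}^{k-1}(M_iR_i)\,B_x,\qquad Q_z=\Big(M_k\prod_{i=1}^{k-1}(M_iR_i)\Big)\Big(N_l\prod_{j=1}^{l-1}(N_jS_j)\Big)B_z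 .$$ **(1)** If $\phi$ and $\psi$ are $L_\phi$- and $L_\psi$-Lipschitz on $[0,1]$, then with probability at least $1-2\delta$ over the training samples, every minimizer $\hat\theta^*$ satisfies $$d^{(\ell)}(P_r,P_{G_{\hat\theta^*}})-\inf_{\theta\in\Theta}d^{(\ell)}(P_r,P_{G_\theta})\le\frac{L_\phi Q_x\sqrt{3k}}{\sqrt n}+\frac{L_\psi Q_z\sqrt{3(k+l-1)}}{\sqrt m}+\sqrt{\log\tfrac1\delta}\Big(\frac{L_\phi Q_x}{\sqrt{2n}}+\frac{L_\psi Q_z}{\sqrt{2m}}\Big).$$ **(2)** ($\alpha$-GAN) Let $\alpha\in(0,\infty]$ and let $\ell=\ell_\alpha$ be the $\alpha$-loss, $\ell_\alpha(1,t)=\ell_\alpha(0,1-t)=\frac{\alpha}{\alpha-1}\big(1-t^{\frac{\alpha-1}{\alpha}}\big)$, read as $-\log t$ for $\alpha=1$ and as $1-t$ for $\alpha=\infty$. (No Lipschitz assumption is made here.) Then with probability at least $1-2\delta$ over the training samples, every minimizer $\hat\theta^*$ satisfies $$d^{(\ell_\alpha)}(P_r,P_{G_{\hat\theta^*}})-\inf_{\theta\in\Theta}d^{(\ell_\alpha)}(P_r,P_{G_\theta})\le\frac{4C_{Q_x}(\alpha)Q_x\sqrt{3k}}{\sqrt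 n}+\frac{4C_{Q_z}(\alpha)Q_z\sqrt{3(k+l-1)}}{\sqrt m}+2\sqrt{2\log\tfrac1\delta}\Big(\frac{C_{Q_x}(\alpha)Q_x}{\sqrt n}+\frac{C_{Q_z}(\alpha)Q_z}{\sqrt m}\Big),$$ where $$C_h(\alpha)=\begin{cases}\sigma(h)\,\sigma(-h)^{\frac{\alpha-1}{\alpha}},&\alpha\in(0,1],\\[2pt]\Big(\frac{\alpha-1}{2\alpha-1}\Big)^{\frac{\alpha-1}{\alpha}}\frac{\alpha}{2\alpha-1},&\alpha\in(1,\infty),\\[2pt]\frac14,&\alpha=\infty.\end{cases}$$ -/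

import Mathlib

open MeasureTheory ProbabilityTheory
open scoped NNReal ENNReal

noncomputable section

namespace CPEGAN

/-! ### Feed-forward networks -/

/-- Weight matrices of `h` hidden layers with layer widths `p 0` (input), `p 1`, …, `p h`:
the matrix with index `i` (counted from zero) maps `ℝ^(p i)` to `ℝ^(p (i + 1))`. -/
abbrev HiddenWeights (p : ℕ → ℕ) (h : ℕ) : Type :=
  ∀ i : Fin h, Matrix (Fin (p (i + 1))) (Fin (p i)) ℝ

/-- The map `x ↦ r_h (W_h r_{h-1} (W_{h-1} ⋯ r_1 (W_1 x)))`, where the activation functions act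
entrywise. For `h = 0` it is the identity. -/
def hiddenMap (p : ℕ → ℕ) : (h : ℕ) → (Fin h → ℝ → ℝ) → HiddenWeights p h →
    EuclideanSpace ℝ (Fin (p 0)) → EuclideanSpace ℝ (Fin (p h))
  | 0, _, _, x => x
  | h + 1, r, W, x =>
      WithLp.toLp 2 fun a : Fin (p (h + 1)) =>
        r (Fin.last h) (Matrix.mulVec (W (Fin.last h))
          (hiddenMap p h (fun i => r i.castSucc) (fun i => W i.castSucc) x).ofLp a)

/-- Parameters `ω = (W_1, …, W_{k-1}, w_k)` of a discriminator with `k` layers. -/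
abbrev DiscParam (p : ℕ → ℕ) (k : ℕ) : Type :=
  HiddenWeights p (k - 1) × EuclideanSpace ℝ (Fin (p (k - 1)))

/-- `f_ω(x) = w_kᵀ r_{k-1}(W_{k-1} r_{k-2}(⋯ r_1(W_1 x)))`. -/
def discLogit (p : ℕ → ℕ) (k : ℕ) (r : Fin (k - 1) → ℝ → ℝ) (ω : DiscParam p k)
    (x : EuclideanSpace ℝ (Fin (p 0))) : ℝ :=
  inner ℝ ω.2 (hiddenMap p (k - 1) r ω.1 x)

/-- The discriminator `D_ω = σ ∘ f_ω` with `σ(t) = 1 / (1 + e^{-t})`. -/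
def disc (p : ℕ → ℕ) (k : ℕ) (r : Fin (k - 1) → ℝ → ℝ) (ω : DiscParam p k)
    (x : EuclideanSpace ℝ (Fin (p 0))) : ℝ :=
  Real.sigmoid (discLogit p k r ω x)

/-- Parameters `θ = (V_1, …, V_l)` of a generator with `l` layers and output in `ℝ^d`. -/
abbrev GenParam (q : ℕ → ℕ) (l d : ℕ) : Type :=
  HiddenWeights q (l - 1) × Matrix (Fin d) (Fin (q (l - 1))) ℝ

/-- `g_θ(z) = V_l s_{l-1}(V_{l-1} s_{l-2}(⋯ s_1(V_1 z)))`. -/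
def gen (q : ℕ → ℕ) (l d : ℕ) (s : Fin (l - 1) → ℝ → ℝ) (θ : GenParam q l d)
    (z : EuclideanSpace ℝ (Fin (q 0))) : EuclideanSpace ℝ (Fin d) :=
  WithLp.toLp 2 (Matrix.mulVec θ.2 (hiddenMap q (l - 1) s θ.1 z).ofLp)

/-- Positive homogeneity of an activation function. -/
def PosHomogeneous (r : ℝ → ℝ) : Prop := ∀ c : ℝ, 0 ≤ c → ∀ t : ℝ, r (c * t) = c * r t

section Frobenius

open scoped Matrix.Norms.Frobenius

/-- All discriminator parameters with `‖W_i‖_F ≤ M_i` for `i < k` and `‖w_k‖₂ ≤ M_k`. -/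
def discBall (p : ℕ → ℕ) (k : ℕ) (M : Fin (k - 1) → ℝ) (Mk : ℝ) : Set (DiscParam p k) :=
  {ω | (∀ i, ‖ω.1 i‖ ≤ M i) ∧ ‖ω.2‖ ≤ Mk}

/-- All generator parameters with `‖V_j‖_F ≤ N_j` for `j ≤ l`. -/
def genBall (q : ℕ → ℕ) (l d : ℕ) (N : Fin (l - 1) → ℝ) (Nl : ℝ) : Set (GenParam q l d) :=
  {θ | (∀ j, ‖θ.1 j‖ ≤ N j) ∧ ‖θ.2‖ ≤ Nl}

end Frobenius

/-! ### CPE losses and the induced divergence -/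

/-- A class probability estimation loss `ℓ(y, ŷ)`, for a label `y ∈ {0, 1}` and a soft
prediction `ŷ ∈ [0, 1]`. -/
abbrev CPELoss : Type := Fin 2 → ℝ → ℝ

/-- `d^{(ℓ)}(P, Q) = sup_{ω ∈ Ω} (E_P[φ(D_ω(X))] + E_Q[ψ(D_ω(X))]) - φ(1/2) - ψ(1/2)`
with `φ = -ℓ(1, ·)` and `ψ = -ℓ(0, ·)`. -/
def lossDiv (ℓ : CPELoss) {E Ω : Type*} [MeasurableSpace E] (D : Ω → E → ℝ) (S : Set Ω)
    (P Q : Measure E) : ℝ :=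
  (⨆ ω : S, ((∫ x, -ℓ 1 (D ω x) ∂P) + ∫ x, -ℓ 0 (D ω x) ∂Q)) - (-ℓ 1 (1 / 2)) - (-ℓ 0 (1 / 2))

/-- The empirical distribution of `n` points. -/
def empirical {E : Type*} [MeasurableSpace E] {n : ℕ} (x : Fin n → E) : Measure E :=
  (n : ℝ≥0∞)⁻¹ • ∑ i, Measure.dirac (x i)

/-- The `α`-loss, `α ∈ (0, ∞]`, evaluated at the probability `t > 0` assigned to the true label;
the cases `α = 1` (log-loss) and `α = ∞` are the continuous extensions. -/
def alphaPartialLoss (α : ℝ≥0∞) (t : ℝ) : ℝ :=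
  if α = 1 then -Real.log t
  else if α = ⊤ then 1 - t
  else α.toReal / (α.toReal - 1) * (1 - t ^ ((α.toReal - 1) / α.toReal))

/-- The `α`-loss as a CPE loss: `ℓ_α(1, ŷ)` is the partial loss at `ŷ` and `ℓ_α(0, ŷ)` the one at
`1 - ŷ`. -/
def alphaLoss (α : ℝ≥0∞) : CPELoss := fun y t => alphaPartialLoss α (if y = 1 then t else 1 - t)

/-- The constant `C_h(α)`; its value `1/4` at `α = ∞` is the limit. -/
def lipConst (h : ℝ) (α : ℝ≥0∞) : ℝ :=
  if α ≤ 1 then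
    Real.sigmoid h * Real.sigmoid (-h) ^ ((α.toReal - 1) / α.toReal)
  else if α = ⊤ then 1 / 4
  else ((α.toReal - 1) / (2 * α.toReal - 1)) ^ ((α.toReal - 1) / α.toReal) *
    (α.toReal / (2 * α.toReal - 1))

/-- With probability at least `1 - 2δ` over the samples, every minimizer `θ̂` over `Θ` of the
empirical objective `θ ↦ d(P̂_r, P̂_{G_θ})` has estimation error
`d(P_r, P_{G_θ̂}) - inf_{θ ∈ Θ} d(P_r, P_{G_θ})` at most `bound`. Here `P_{G_θ}` is the law of
`g_θ(Z)` with `Z ∼ P_Z`, and `P̂_r`, `P̂_{G_θ}` are the empirical distributions of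
`X_1, …, X_n` and of `g_θ(Z_1), …, g_θ(Z_m)`. -/
def EstimationErrorBound (ℓ : CPELoss) {E F ΩD ΘG S : Type*} [MeasurableSpace E]
    [MeasurableSpace F] [MeasurableSpace S]
    (D : ΩD → E → ℝ) (Ω : Set ΩD) (g : ΘG → F → E) (Θ : Set ΘG)
    (Pr : Measure E) (PZ : Measure F) (μ : Measure S)
    {n m : ℕ} (X : Fin n → S → E) (Z : Fin m → S → F) (δ bound : ℝ) : Prop :=
  ∃ A : Set S, MeasurableSet A ∧ 1 - 2 * δ ≤ μ.real A ∧
    ∀ t ∈ A, ∀ θhat ∈ Θ,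
      IsMinOn (fun θ => lossDiv ℓ D Ω (empirical fun i => X i t) (empirical fun j => g θ (Z j t)))
        Θ θhat →
      lossDiv ℓ D Ω Pr (PZ.map (g θhat)) - ⨅ θ : Θ, lossDiv ℓ D Ω Pr (PZ.map (g θ)) ≤ bound

end CPEGAN

end

noncomputable section

namespace CPEGAN

/-! For an empirical minimizer the estimation error is at most the largest difference between the
deviations (population mean minus empirical mean) at two parameters (`ciSup_sub_le_of_deviation`).
So one controls the sum of the two one-sided maximal deviations, once for the real sample and once
for the noise sample. The second class is indexed by ω and θ jointly, because the minimizer depends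
on the noise; a discriminator after a generator is just a deeper network.

For each sample this sum is a single function with bounded differences, hence concentrates around
its mean (`measure_ge_le_of_boundedDifferences`), with one failure event of probability δ per
sample. Symmetrization bounds the mean by four Rademacher averages (`integral_symmetrization_le`,
used twice).

Rademacher averages are bounded through exponential moments, where losses of constant factors are
cheap. The loss composed with σ is Lipschitz in the logit and is removed by contraction
(`expSup_le_expSup`). A hidden layer is dominated by one normalized neuron, thanks to positive
homogeneity and the Frobenius norm; each such layer costs a factor 2 (`normExpSup_layer_le`), the
linear output layers cost nothing. What remains is a Rademacher sum of the inputs in a Hilbert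
space, which is sub-Gaussian up to one more factor 2 (`sum_exp_norm_le`). Taking logarithms turns
2^k into k log 2, and choosing the rate yields √(3k) (`le_mul_sqrt_of_forall_mul_le`).

The two parts of the theorem differ only in the Lipschitz constant of the loss as a function of the
logit: L/4, because σ' ≤ 1/4, and C_Q(α), the bound for the derivative on [-Q, Q]. -/

/-! ### Sums over sign patterns -/

/-- The sign `±1` encoded by a Boolean. -/
def sgn (b : Bool) : ℝ := if b then 1 else -1

lemma sgn_not (b : Bool) : sgn (!b) = -sgn b := by cases b <;> simp [sgn]

lemma abs_sgn (b : Bool) : |sgn b| = 1 := by cases b <;> simp [sgn]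

/-- Flip one coordinate of a sign pattern. -/
def flipSign {κ : Type*} [DecidableEq κ] (j : κ) (ε : κ → Bool) : κ → Bool :=
  Function.update ε j (!ε j)

lemma flipSign_self {κ : Type*} [DecidableEq κ] (j : κ) (ε : κ → Bool) :
    flipSign j ε j = !ε j := by simp [flipSign]

lemma flipSign_of_ne {κ : Type*} [DecidableEq κ] {j c : κ} (h : c ≠ j) (ε : κ → Bool) :
    flipSign j ε c = ε c := by simp [flipSign, h]

lemma flipSign_involutive {κ : Type*} [DecidableEq κ] (j : κ) :
    Function.Involutive (flipSign (κ := κ) j) := by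
  intro ε; ext c
  by_cases h : c = j
  · subst h; simp [flipSign_self]
  · simp [flipSign_of_ne h]

lemma sum_flipSign {κ : Type*} [Fintype κ] [DecidableEq κ] {A : Type*} [AddCommMonoid A]
    (j : κ) (f : (κ → Bool) → A) : ∑ ε, f (flipSign j ε) = ∑ ε, f ε :=
  Equiv.sum_comp (flipSign_involutive j).toPerm f

lemma sum_not {κ : Type*} [Fintype κ] [DecidableEq κ] {A : Type*} [AddCommMonoid A]
    (f : (κ → Bool) → A) : ∑ ε : κ → Bool, f (fun c => !ε c) = ∑ ε, f ε :=
  Equiv.sum_comp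
    (Function.Involutive.toPerm (fun (ε : κ → Bool) c => !ε c) (fun ε => by ext c; simp)) f

/-- Flipping is a bijection, so pairing each pattern with its flip counts both sums twice. Sign
averages can thus be compared one sign at a time. -/
lemma sum_le_sum_of_flipSign {κ : Type*} [Fintype κ] [DecidableEq κ] (j : κ)
    (f g : (κ → Bool) → ℝ) (h : ∀ ε, f ε + f (flipSign j ε) ≤ g ε + g (flipSign j ε)) :
    ∑ ε, f ε ≤ ∑ ε, g ε := by
  have := Finset.sum_le_sum fun ε (_ : ε ∈ Finset.univ) => h ε
  rw [Finset.sum_add_distrib, Finset.sum_add_distrib, sum_flipSign, sum_flipSign] at this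
  linarith

lemma sum_le_sum_of_flipSign_ennreal {κ : Type*} [Fintype κ] [DecidableEq κ] (j : κ)
    (f g : (κ → Bool) → ℝ≥0∞) (h : ∀ ε, f ε + f (flipSign j ε) ≤ g ε + g (flipSign j ε)) :
    ∑ ε, f ε ≤ ∑ ε, g ε := by
  have := Finset.sum_le_sum fun ε (_ : ε ∈ Finset.univ) => h ε
  rw [Finset.sum_add_distrib, Finset.sum_add_distrib, sum_flipSign, sum_flipSign, ← two_mul,
    ← two_mul] at this
  exact (ENNReal.mul_le_mul_iff_right (by simp) (by simp)).1 this

/-! ### The contraction principle for exponential moments -/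

/-- Increments of `exp` grow with the starting point and with the length. This settles the same-sign
cases of the two-point inequality. -/
lemma exp_increment_le {u v h h' : ℝ} (huv : u ≤ v) (hh : h ≤ h') (h0 : 0 ≤ h) :
    Real.exp (u + h) - Real.exp u ≤ Real.exp (v + h') - Real.exp v := by
  rw [Real.exp_add, Real.exp_add]
  have h1 : Real.exp u ≤ Real.exp v := Real.exp_le_exp.2 huv
  have h2 : Real.exp h ≤ Real.exp h' := Real.exp_le_exp.2 hh
  have h3 : 1 ≤ Real.exp h := Real.one_le_exp h0
  have h4 := Real.exp_pos v
  have h5 : Real.exp u * (Real.exp h - 1) ≤ Real.exp v * (Real.exp h' - 1) :=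
    mul_le_mul h1 (by linarith) (by linarith) h4.le
  linarith

lemma exp_add_exp_sub_le {b x y : ℝ} (h : |x| ≤ |y|) :
    Real.exp (b + x) + Real.exp (b - x) ≤ Real.exp (b + y) + Real.exp (b - y) := by
  have := Real.cosh_le_cosh.2 h
  rw [Real.cosh_eq, Real.cosh_eq] at this
  simp only [sub_eq_add_neg, Real.exp_add]
  nlinarith [Real.exp_pos b]

/-- The two-point inequality behind the contraction principle. -/
lemma contraction_two_point {a b x x' y y' U V : ℝ} (hx : |x| ≤ |y|) (hx' : |x'| ≤ |y'|)
    (hxx : |x - x'| ≤ |y - y'|) (h1 : Real.exp (a + y) ≤ U) (h2 : Real.exp (b + y') ≤ U)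
    (h3 : Real.exp (a - y) ≤ V) (h4 : Real.exp (b - y') ≤ V) :
    Real.exp (a + x) + Real.exp (b - x') ≤ U + V := by
  -- If `a + x < b + x'`, replacing the first point by the second increases the sum, and for a
  -- single point monotonicity of `cosh` suffices; `c2` is the mirror case.
  by_cases c1 : a + x < b + x'
  · have := exp_add_exp_sub_le (b := b) hx'
    have := Real.exp_lt_exp.2 c1
    linarith
  by_cases c2 : b - x' < a - x
  · have := exp_add_exp_sub_le (b := a) hx
    have := Real.exp_lt_exp.2 c2
    linarith
  push Not at c1 c2
  have hxl := abs_le.1 hx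
  have hxl' := abs_le.1 hx'
  -- Each `key` treats one order of `|y|`, `|y'|` with equal signs: the rise of one exponential to
  -- its bound pays for the fall of the other.
  have key1 : y' - x' ≤ y - x → 0 ≤ y' - x' → -y' ≤ x' →
      Real.exp (a + x) + Real.exp (b - x') ≤ U + V := by
    intro i1 i2 i3
    have := exp_increment_le (u := b - y') (v := a + x) (by linarith) i1 i2
    rw [show b - y' + (y' - x') = b - x' by ring, show a + x + (y - x) = a + y by ring] at this
    linarith
  have key2 : y + x ≤ y' + x' → 0 ≤ y + x → x ≤ y →
      Real.exp (a + x) + Real.exp (b - x') ≤ U + V := by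
    intro i1 i2 i3
    have := exp_increment_le (u := a - y) (v := b - x') (by linarith) i1 i2
    rw [show a - y + (y + x) = a + x by ring, show b - x' + (y' + x') = b + y' by ring] at this
    linarith
  have key3 : -y' - x' ≤ -y - x → 0 ≤ -y' - x' → y' ≤ x' →
      Real.exp (a + x) + Real.exp (b - x') ≤ U + V := by
    intro i1 i2 i3
    have := exp_increment_le (u := b + y') (v := a + x) (by linarith) i1 i2
    rw [show b + y' + (-y' - x') = b - x' by ring, show a + x + (-y - x) = a - y by ring] at this
    linarith
  have key4 : -y + x ≤ -y' + x' → 0 ≤ -y + x → x ≤ -y →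
      Real.exp (a + x) + Real.exp (b - x') ≤ U + V := by
    intro i1 i2 i3
    have := exp_increment_le (u := a + y) (v := b - x') (by linarith) i1 i2
    rw [show a + y + (-y + x) = a + x by ring, show b - x' + (-y' + x') = b - y' by ring] at this
    linarith
  have hxx1 := abs_le.1 hxx
  rcases le_total 0 y with hy | hy <;> rcases le_total 0 y' with hy' | hy'
  · rw [abs_of_nonneg hy] at hxl
    rw [abs_of_nonneg hy'] at hxl'
    rcases le_total y' y with hh | hh
    · rw [abs_of_nonneg (by linarith)] at hxx1
      exact key1 (by linarith) (by linarith) (by linarith)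
    · rw [abs_of_nonpos (by linarith)] at hxx1
      exact key2 (by linarith) (by linarith) (by linarith)
  · rw [abs_of_nonneg hy] at hxl
    rw [abs_of_nonpos hy'] at hxl'
    -- For opposite signs one exponential is bounded by `U`, the other by `V`, so the comparison is
    -- termwise.
    have := Real.exp_le_exp.2 (show a + x ≤ a + y by linarith)
    have := Real.exp_le_exp.2 (show b - x' ≤ b - y' by linarith)
    linarith
  · rw [abs_of_nonpos hy] at hxl
    rw [abs_of_nonneg hy'] at hxl'
    have := Real.exp_le_exp.2 (show a + x ≤ a - y by linarith)
    have := Real.exp_le_exp.2 (show b - x' ≤ b + y' by linarith)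
    linarith
  · rw [abs_of_nonpos hy] at hxl
    rw [abs_of_nonpos hy'] at hxl'
    rcases le_total y' y with hh | hh
    · rw [abs_of_nonneg (by linarith)] at hxx1
      exact key4 (by linarith) (by linarith) (by linarith)
    · rw [abs_of_nonpos (by linarith)] at hxx1
      exact key3 (by linarith) (by linarith) (by linarith)

/-- Suprema in `ℝ≥0∞` require no boundedness; each pair of indices is an instance of the two-point
inequality. -/
lemma iSup_exp_add_iSup_exp_le {ι : Type*} [Nonempty ι] (a x y : ι → ℝ)
    (h : ∀ i, |x i| ≤ |y i|) (h' : ∀ i j, |x i - x j| ≤ |y i - y j|) :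
    (⨆ i, ENNReal.ofReal (Real.exp (a i + x i))) + (⨆ i, ENNReal.ofReal (Real.exp (a i - x i)))
      ≤ (⨆ i, ENNReal.ofReal (Real.exp (a i + y i)))
        + ⨆ i, ENNReal.ofReal (Real.exp (a i - y i)) := by
  refine ENNReal.iSup_add_iSup_le fun i j => ?_
  set U := ⨆ i, ENNReal.ofReal (Real.exp (a i + y i)) with hU
  set V := ⨆ i, ENNReal.ofReal (Real.exp (a i - y i)) with hV
  by_cases hUt : U = ⊤
  · simp [hUt]
  by_cases hVt : V = ⊤
  · simp [hVt]
  have bU : ∀ i, Real.exp (a i + y i) ≤ U.toReal := fun i =>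
    (ENNReal.ofReal_le_iff_le_toReal hUt).1 (le_iSup (fun i => ENNReal.ofReal _) i)
  have bV : ∀ i, Real.exp (a i - y i) ≤ V.toReal := fun i =>
    (ENNReal.ofReal_le_iff_le_toReal hVt).1 (le_iSup (fun i => ENNReal.ofReal _) i)
  rw [← ENNReal.ofReal_add (Real.exp_pos _).le (Real.exp_pos _).le,
    ← ENNReal.ofReal_toReal hUt, ← ENNReal.ofReal_toReal hVt,
    ← ENNReal.ofReal_add ENNReal.toReal_nonneg ENNReal.toReal_nonneg]
  exact ENNReal.ofReal_le_ofReal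
    (contraction_two_point (h i) (h j) (h' i j) (bU i) (bU j) (bV i) (bV j))

/-- The exponential moment `∑_ε sup_i exp (∑_c ε_c x_{i,c})` of a Rademacher process. -/
def expSup {ι κ : Type*} [Fintype κ] [DecidableEq κ] (x : ι → κ → ℝ) : ℝ≥0∞ :=
  ∑ ε : κ → Bool, ⨆ i, ENNReal.ofReal (Real.exp (∑ c, sgn (ε c) * x i c))

/-- With the other signs frozen, their partial sum plays the role of `a` in the two-supremum
inequality. -/
lemma expSup_update_le {ι κ : Type*} [Nonempty ι] [Fintype κ] [DecidableEq κ]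
    (x : ι → κ → ℝ) (j : κ) (y : ι → ℝ) (h : ∀ i, |x i j| ≤ |y i|)
    (h' : ∀ i i', |x i j - x i' j| ≤ |y i - y i'|) :
    expSup x ≤ expSup fun i => Function.update (x i) j (y i) := by
  refine sum_le_sum_of_flipSign_ennreal j _ _ fun ε => ?_
  have e1 : ∀ (v : κ → ℝ), ∑ c, sgn (ε c) * v c
      = (∑ c ∈ Finset.univ.erase j, sgn (ε c) * v c) + sgn (ε j) * v j := fun v =>
    (Finset.sum_erase_add _ _ (Finset.mem_univ j)).symm
  have e2 : ∀ (v : κ → ℝ), ∑ c, sgn (flipSign j ε c) * v c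
      = (∑ c ∈ Finset.univ.erase j, sgn (ε c) * v c) - sgn (ε j) * v j := fun v => by
    rw [← Finset.sum_erase_add _ _ (Finset.mem_univ j), flipSign_self, sgn_not]
    rw [Finset.sum_congr rfl fun c hc => by rw [flipSign_of_ne (Finset.ne_of_mem_erase hc)]]
    ring
  have e3 : ∀ i, (∑ c ∈ Finset.univ.erase j, sgn (ε c) * Function.update (x i) j (y i) c)
      = ∑ c ∈ Finset.univ.erase j, sgn (ε c) * x i c := fun i =>
    Finset.sum_congr rfl fun c hc => by
      rw [Function.update_of_ne (Finset.ne_of_mem_erase hc)]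
  simp only [e1, e2, e3, Function.update_self]
  refine iSup_exp_add_iSup_exp_le _ _ _ (fun i => ?_) (fun i i' => ?_)
  · simpa [abs_mul, abs_sgn] using h i
  · rw [← mul_sub, ← mul_sub, abs_mul, abs_mul, abs_sgn]
    simpa using h' i i'

/-- The contraction principle. -/
lemma expSup_le_expSup {ι κ : Type*} [Nonempty ι] [Fintype κ] [DecidableEq κ]
    (x y : ι → κ → ℝ) (h : ∀ i c, |x i c| ≤ |y i c|)
    (h' : ∀ i i' c, |x i c - x i' c| ≤ |y i c - y i' c|) : expSup x ≤ expSup y := by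
  -- `F` collects the coordinates already replaced.
  have key : ∀ F : Finset κ, expSup x ≤ expSup fun i c => if c ∈ F then y i c else x i c := by
    intro F
    induction F using Finset.induction_on with
    | empty => simp
    | insert j F hj ih =>
      refine ih.trans ((expSup_update_le _ j (fun i => y i j) ?_ ?_).trans_eq ?_)
      · intro i; simpa [hj] using h i j
      · intro i i'; simpa [hj] using h' i i' j
      · congr 1; ext i c
        by_cases hc : c = j
        · subst hc; simp
        · simp [hc]
  simpa using key Finset.univ

/-! ### Exponential moments of Rademacher sums in a Hilbert space -/

/-- In the induction, the sum for `k + 1` is `a` times the sum for `k` plus `b` times the difference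
for `k`; both parts are largest at `b = c`. -/
lemma pow_add_pow_le_of_abs_le {a b c : ℝ} (hbc : |b| ≤ c) (hca : c ≤ a) (k : ℕ) :
    (a + b) ^ k + (a - b) ^ k ≤ (a + c) ^ k + (a - c) ^ k := by
  induction k with
  | zero => simp
  | succ k ih =>
    have hb := abs_le.1 hbc
    have hc : 0 ≤ c := (abs_nonneg b).trans hbc
    have hdiff : |b| * |(a + b) ^ k - (a - b) ^ k| ≤ c * ((a + c) ^ k - (a - c) ^ k) := by
      refine mul_le_mul hbc (abs_le.2 ⟨?_, ?_⟩) (abs_nonneg _) hc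
      · have := pow_le_pow_left₀ (by linarith) (show a - b ≤ a + c by linarith) k
        have := pow_le_pow_left₀ (by linarith) (show a - c ≤ a + b by linarith) k
        linarith
      · have := pow_le_pow_left₀ (by linarith) (show a + b ≤ a + c by linarith) k
        have := pow_le_pow_left₀ (by linarith) (show a - c ≤ a - b by linarith) k
        linarith
    have hdiff' : b * ((a + b) ^ k - (a - b) ^ k) ≤ c * ((a + c) ^ k - (a - c) ^ k) := by
      refine le_trans ?_ hdiff
      rw [← abs_mul]; exact le_abs_self _
    have ha : 0 ≤ a := by linarith
    have := mul_le_mul_of_nonneg_left ih ha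
    simp only [pow_succ]
    linarith

/-- `cosh ‖·‖` is a power series in the squared norm with nonnegative coefficients. Termwise,
Cauchy–Schwarz makes parallel vectors the worst case, where equality holds. -/
lemma cosh_norm_add_le {H : Type*} [NormedAddCommGroup H] [InnerProductSpace ℝ H] (s x : H) :
    Real.cosh ‖s + x‖ + Real.cosh ‖s - x‖ ≤ 2 * (Real.cosh ‖s‖ * Real.cosh ‖x‖) := by
  have h1 : 2 * (Real.cosh ‖s‖ * Real.cosh ‖x‖)
      = Real.cosh (‖s‖ + ‖x‖) + Real.cosh (‖s‖ - ‖x‖) := by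
    rw [Real.cosh_add, Real.cosh_sub]; ring
  rw [h1]
  refine hasSum_le (fun k => ?_) ((Real.hasSum_cosh _).add (Real.hasSum_cosh _))
    ((Real.hasSum_cosh _).add (Real.hasSum_cosh _))
  rw [← add_div, ← add_div]
  refine div_le_div_of_nonneg_right ?_ (Nat.cast_nonneg _)
  rw [pow_mul, pow_mul, pow_mul, pow_mul, norm_add_sq_real, norm_sub_sq_real, add_sq, sub_sq]
  have := pow_add_pow_le_of_abs_le (a := ‖s‖ ^ 2 + ‖x‖ ^ 2) (b := 2 * inner ℝ s x)
    (c := 2 * ‖s‖ * ‖x‖) (by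
      rw [abs_mul, abs_of_pos (two_pos : (0 : ℝ) < 2), mul_assoc]
      exact mul_le_mul_of_nonneg_left (abs_real_inner_le_norm s x) two_pos.le)
    (by nlinarith [sq_nonneg (‖s‖ - ‖x‖)]) k
  refine le_trans (le_of_eq ?_) (this.trans (le_of_eq ?_)) <;> ring

/-- On average over the signs, each summand contributes at most a factor `cosh ‖x c‖`, whatever the
dimension. -/
lemma sum_cosh_norm_le {H κ : Type*} [NormedAddCommGroup H] [InnerProductSpace ℝ H]
    [Fintype κ] [DecidableEq κ] (x : κ → H) (F : Finset κ) :
    ∑ ε : κ → Bool, Real.cosh ‖∑ c ∈ F, sgn (ε c) • x c‖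
      ≤ 2 ^ Fintype.card κ * ∏ c ∈ F, Real.cosh ‖x c‖ := by
  induction F using Finset.induction_on with
  | empty => simp
  | insert j F hj ih =>
    calc _ ≤ ∑ ε : κ → Bool, Real.cosh ‖∑ c ∈ F, sgn (ε c) • x c‖ * Real.cosh ‖x j‖ := by
          refine sum_le_sum_of_flipSign j _ _ fun ε => ?_
          have e : ∑ c ∈ F, sgn (flipSign j ε c) • x c = ∑ c ∈ F, sgn (ε c) • x c :=
            Finset.sum_congr rfl fun c hc => by
              rw [flipSign_of_ne (ne_of_mem_of_not_mem hc hj)]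
          rw [Finset.sum_insert hj, Finset.sum_insert hj, e, flipSign_self, sgn_not, neg_smul]
          have := cosh_norm_add_le (∑ c ∈ F, sgn (ε c) • x c) (sgn (ε j) • x j)
          rw [norm_smul, Real.norm_eq_abs, abs_sgn, one_mul] at this
          rw [add_comm (sgn (ε j) • x j), neg_add_eq_sub]
          linarith
      _ ≤ _ := by
          rw [← Finset.sum_mul, Finset.prod_insert hj]
          calc _ ≤ (2 ^ Fintype.card κ * ∏ c ∈ F, Real.cosh ‖x c‖) * Real.cosh ‖x j‖ :=
                mul_le_mul_of_nonneg_right ih (Real.cosh_pos _).le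
            _ = _ := by ring

/-- Combines `exp t ≤ 2 cosh t` with `cosh t ≤ exp (t² / 2)`. The factor 2 is the origin of the `+
1` in `K + 1` below. -/
lemma sum_exp_norm_le {H : Type*} [NormedAddCommGroup H] [InnerProductSpace ℝ H]
    {n : ℕ} (x : Fin n → H) {B : ℝ} (hx : ∀ c, ‖x c‖ ≤ B) {a : ℝ} (ha : 0 ≤ a) :
    ∑ ε : Fin n → Bool, Real.exp (a * ‖∑ c, sgn (ε c) • x c‖)
      ≤ 2 ^ n * (2 * Real.exp (a ^ 2 * B ^ 2 * n / 2)) := by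
  have h1 : ∀ ε : Fin n → Bool, Real.exp (a * ‖∑ c, sgn (ε c) • x c‖)
      ≤ 2 * Real.cosh ‖∑ c, sgn (ε c) • (a • x c)‖ := fun ε => by
    have e : ∑ c, sgn (ε c) • (a • x c) = a • ∑ c, sgn (ε c) • x c := by
      rw [Finset.smul_sum]; exact Finset.sum_congr rfl fun c _ => smul_comm _ _ _
    rw [e, norm_smul, Real.norm_eq_abs, abs_of_nonneg ha, Real.cosh_eq]
    have := Real.exp_pos (-(a * ‖∑ c, sgn (ε c) • x c‖))
    linarith
  refine (Finset.sum_le_sum fun ε _ => h1 ε).trans ?_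
  rw [← Finset.mul_sum]
  have h2 := sum_cosh_norm_le (fun c => a • x c) Finset.univ
  have h3 : ∏ c, Real.cosh ‖a • x c‖ ≤ Real.exp (a ^ 2 * B ^ 2 * n / 2) := by
    calc _ ≤ ∏ _c : Fin n, Real.exp (a ^ 2 * B ^ 2 / 2) := by
          refine Finset.prod_le_prod (fun _ _ => (Real.cosh_pos _).le) fun c _ => ?_
          refine (Real.cosh_le_exp_half_sq _).trans (Real.exp_le_exp.2 ?_)
          rw [norm_smul, mul_pow, Real.norm_eq_abs, sq_abs]
          have := pow_le_pow_left₀ (norm_nonneg _) (hx c) 2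
          have := mul_le_mul_of_nonneg_left this (sq_nonneg a)
          linarith
      _ = _ := by
          rw [Finset.prod_const, ← Real.exp_nat_mul]
          simp only [Finset.card_univ, Fintype.card_fin]
          congr 1; ring
  rw [Fintype.card_fin] at h2
  have h4 : (2 : ℝ) ^ n * ∏ c, Real.cosh ‖a • x c‖ ≤ 2 ^ n * Real.exp (a ^ 2 * B ^ 2 * n / 2) :=
    mul_le_mul_of_nonneg_left h3 (by positivity)
  linarith

/-! ### From exponential moments to Rademacher complexities -/

/-- For an unbounded family the real supremum is 0 by convention, but then the right-hand side is
`⊤`. -/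
lemma ofReal_exp_ciSup_le {ι : Type*} [Nonempty ι] (y : ι → ℝ) {a : ℝ} (ha : 0 < a) :
    ENNReal.ofReal (Real.exp (a * ⨆ i, y i)) ≤ ⨆ i, ENNReal.ofReal (Real.exp (a * y i)) := by
  set B := ⨆ i, ENNReal.ofReal (Real.exp (a * y i)) with hB
  by_cases hBt : B = ⊤
  · simp [hBt]
  have b : ∀ i, Real.exp (a * y i) ≤ B.toReal := fun i =>
    (ENNReal.ofReal_le_iff_le_toReal hBt).1 (le_iSup (fun i => ENNReal.ofReal _) i)
  have hpos : 0 < B.toReal := (Real.exp_pos _).trans_le (b (Classical.arbitrary ι))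
  rw [ENNReal.ofReal_le_iff_le_toReal hBt, ← Real.le_log_iff_exp_le hpos]
  rw [← le_div_iff₀' ha]
  refine ciSup_le fun i => ?_
  rw [le_div_iff₀' ha, Real.le_log_iff_exp_le hpos]
  exact b i

/-- The rate `a = √K / q` is good enough, since (log 2 + 1/2)² < 3. -/
lemma le_mul_sqrt_of_forall_mul_le {ρ q K : ℝ} (hq : 0 ≤ q) (hK : 0 < K)
    (h : ∀ a : ℝ, 0 < a → a * ρ ≤ K * Real.log 2 + a ^ 2 * q ^ 2 / 2) :
    ρ ≤ q * √(3 * K) := by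
  have hl := Real.log_two_lt_d9
  have hl0 : 0 < Real.log 2 := Real.log_pos one_lt_two
  rcases hq.eq_or_lt with rfl | hq
  · by_contra hc
    have hρ : 0 < ρ := by simpa using hc
    -- With `q = 0` this reads `K ≤ K log 2`, impossible because log 2 < 1.
    have := h (K / ρ) (by positivity)
    rw [div_mul_cancel₀ _ hρ.ne'] at this
    nlinarith
  have hs : 0 < √K := Real.sqrt_pos.2 hK
  have hss : √K * √K = K := Real.mul_self_sqrt hK.le
  have h1 := h (√K / q) (by positivity)
  have h2 : √K * ρ ≤ q * (K * Real.log 2 + K / 2) := by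
    have e : (√K / q) ^ 2 * q ^ 2 / 2 = K / 2 := by
      field_simp; rw [sq, hss]
    rw [e, div_mul_eq_mul_div, div_le_iff₀ hq] at h1
    linarith
  have h3 : ρ ≤ q * (√K * (Real.log 2 + 1 / 2)) := by
    have : √K * ρ ≤ √K * (q * (√K * (Real.log 2 + 1 / 2))) := by
      refine h2.trans (le_of_eq ?_)
      calc _ = q * (√K * √K * (Real.log 2 + 1 / 2)) := by rw [hss]; ring
        _ = _ := by ring
    exact le_of_mul_le_mul_left this hs
  refine h3.trans (mul_le_mul_of_nonneg_left ?_ hq.le)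
  rw [Real.sqrt_mul (by norm_num), mul_comm (√3)]
  refine mul_le_mul_of_nonneg_left ?_ hs.le
  refine Real.le_sqrt_of_sq_le ?_
  nlinarith

/-- A class of real functions whose exponential Rademacher moments are dominated, up to a factor
`2 ^ K`, by those of Rademacher sums of the inputs has small Rademacher complexity after composition
with a Lipschitz function. -/
lemma rademacher_le {ι H : Type*} [Nonempty ι] [NormedAddCommGroup H] [InnerProductSpace ℝ H]
    {n : ℕ} (f : ι → H → ℝ) (A B C : ℝ) (K : ℕ) (hA : 0 ≤ A) (hB : 0 ≤ B) (hC : 0 ≤ C)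
    (hf : ∀ i x, |f i x| ≤ A * ‖x‖)
    (hexp : ∀ a : ℝ, 0 ≤ a → ∀ x : Fin n → H, expSup (fun i c => a * f i (x c))
      ≤ 2 ^ K * ∑ ε : Fin n → Bool, ENNReal.ofReal (Real.exp (a * A * ‖∑ c, sgn (ε c) • x c‖)))
    (h : ℝ → ℝ) (h0 : h 0 = 0)
    (hLip : ∀ s t, |s| ≤ A * B → |t| ≤ A * B → |h s - h t| ≤ C * |s - t|)
    (x : Fin n → H) (hx : ∀ c, ‖x c‖ ≤ B) :
    ∑ ε : Fin n → Bool, ⨆ i, ∑ c, sgn (ε c) * h (f i (x c))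
      ≤ 2 ^ n * (C * (A * B) * √n * √(3 * (K + 1))) := by
  have hAB : 0 ≤ A * B := mul_nonneg hA hB
  have hfx : ∀ i c, |f i (x c)| ≤ A * B := fun i c =>
    (hf i (x c)).trans (mul_le_mul_of_nonneg_left (hx c) hA)
  rw [← div_le_iff₀' (by positivity)]
  refine le_mul_sqrt_of_forall_mul_le (by positivity) (by positivity) fun a ha => ?_
  set Y : (Fin n → Bool) → ℝ := fun ε => ⨆ i, ∑ c, sgn (ε c) * h (f i (x c)) with hY
  -- Jensen's inequality for the uniform distribution on sign patterns.
  have hJ : Real.exp (a * ((∑ ε, Y ε) / 2 ^ n)) ≤ (∑ ε, Real.exp (a * Y ε)) / 2 ^ n := by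
    have := convexOn_exp.map_sum_le (t := (Finset.univ : Finset (Fin n → Bool)))
      (w := fun _ => (1 / 2 ^ n : ℝ)) (p := fun ε => a * Y ε) (fun _ _ => by positivity)
      (by simp) (fun _ _ => Set.mem_univ _)
    simp only [smul_eq_mul, ← Finset.mul_sum] at this
    refine le_trans (le_of_eq ?_) (this.trans (le_of_eq ?_))
    · congr 1; ring
    · ring
  -- In turn: `exp` passes inside the supremum, contraction removes `h`, `hexp` removes the class,
  -- and the Hilbert space bound concludes.
  have hE : ENNReal.ofReal (∑ ε, Real.exp (a * Y ε))
      ≤ ENNReal.ofReal (2 ^ K * (2 ^ n * (2 * Real.exp ((a * C * A) ^ 2 * B ^ 2 * n / 2)))) := by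
    calc ENNReal.ofReal (∑ ε, Real.exp (a * Y ε))
        = ∑ ε, ENNReal.ofReal (Real.exp (a * Y ε)) :=
          ENNReal.ofReal_sum_of_nonneg fun _ _ => (Real.exp_pos _).le
      _ ≤ expSup (fun i c => a * h (f i (x c))) := by
          refine Finset.sum_le_sum fun ε _ => (ofReal_exp_ciSup_le _ ha).trans (le_of_eq ?_)
          congr 1; ext i; congr 2
          rw [Finset.mul_sum]; exact Finset.sum_congr rfl fun c _ => by ring
      _ ≤ expSup (fun i c => (a * C) * f i (x c)) := by
          refine expSup_le_expSup _ _ (fun i c => ?_) (fun i i' c => ?_)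
          · rw [abs_mul, mul_assoc, abs_mul a]
            refine mul_le_mul_of_nonneg_left ?_ (abs_nonneg a)
            have := hLip (f i (x c)) 0 (hfx i c) (by simpa using hAB)
            rw [abs_mul, abs_of_nonneg hC]
            simpa [h0] using this
          · rw [← mul_sub, ← mul_sub, abs_mul, mul_assoc, abs_mul a]
            refine mul_le_mul_of_nonneg_left ?_ (abs_nonneg a)
            rw [abs_mul, abs_of_nonneg hC]
            exact hLip _ _ (hfx i c) (hfx i' c)
      _ ≤ 2 ^ K * ∑ ε : Fin n → Bool,
            ENNReal.ofReal (Real.exp (a * C * A * ‖∑ c, sgn (ε c) • x c‖)) :=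
          hexp _ (by positivity) x
      _ = ENNReal.ofReal (2 ^ K * ∑ ε : Fin n → Bool,
            Real.exp (a * C * A * ‖∑ c, sgn (ε c) • x c‖)) := by
          rw [ENNReal.ofReal_mul (by positivity),
            ENNReal.ofReal_sum_of_nonneg fun _ _ => (Real.exp_pos _).le,
            ENNReal.ofReal_pow (by norm_num)]
          simp
      _ ≤ _ := by
          refine ENNReal.ofReal_le_ofReal (mul_le_mul_of_nonneg_left ?_ (by positivity))
          exact sum_exp_norm_le x hx (by positivity)
  rw [ENNReal.ofReal_le_ofReal_iff (by positivity)] at hE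
  have hF : Real.exp (a * ((∑ ε, Y ε) / 2 ^ n))
      ≤ Real.exp ((K + 1) * Real.log 2 + a ^ 2 * (C * (A * B) * √n) ^ 2 / 2) := by
    refine hJ.trans ?_
    rw [div_le_iff₀ (by positivity)]
    refine hE.trans (le_of_eq ?_)
    rw [Real.exp_add, mul_pow _ (√n), Real.sq_sqrt (Nat.cast_nonneg n)]
    have : Real.exp ((K + 1) * Real.log 2) = 2 ^ K * 2 := by
      rw [add_mul, one_mul, Real.exp_add, Real.exp_nat_mul, Real.exp_log two_pos]
    rw [this, show (a * C * A) ^ 2 * B ^ 2 * n / 2 = a ^ 2 * ((C * (A * B)) ^ 2 * n) / 2 by ring]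
    ring
  exact Real.exp_le_exp.1 hF

/-! ### Peeling off the layers of a network -/

lemma PosHomogeneous.map_zero {r : ℝ → ℝ} (hr : PosHomogeneous r) : r 0 = 0 := by
  simpa using hr 0 le_rfl 0

lemma PosHomogeneous.abs_le {r : ℝ → ℝ} (hr : PosHomogeneous r) {R : ℝ≥0}
    (hL : LipschitzWith R r) (t : ℝ) : |r t| ≤ R * |t| := by
  have := hL.dist_le_mul t 0
  simpa [Real.dist_eq, hr.map_zero] using this

section Frobenius

open scoped Matrix.Norms.Frobenius

lemma frobenius_norm_sq {d d' : ℕ} (W : Matrix (Fin d') (Fin d) ℝ) :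
    ‖W‖ ^ 2 = ∑ a, ‖(WithLp.toLp 2 (W a) : EuclideanSpace ℝ (Fin d))‖ ^ 2 := by
  rw [Matrix.frobenius_norm_def, ← Real.sqrt_eq_rpow, Real.sq_sqrt (by positivity)]
  refine Finset.sum_congr rfl fun a _ => ?_
  rw [EuclideanSpace.norm_sq_eq]
  simp

lemma mulVec_eq_inner {d d' : ℕ} (W : Matrix (Fin d') (Fin d) ℝ) (x : EuclideanSpace ℝ (Fin d))
    (a : Fin d') :
    Matrix.mulVec W x.ofLp a = inner ℝ (WithLp.toLp 2 (W a) : EuclideanSpace ℝ (Fin d)) x := by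
  simp [Matrix.mulVec, dotProduct, PiLp.inner_apply, mul_comm]

/-- This is where the Frobenius norm is needed: bounds proportional to the row norms add up in
squares to `‖W‖ ^ 2`. -/
lemma norm_le_of_abs_le_mul_row {d d' : ℕ} (W : Matrix (Fin d') (Fin d) ℝ) {M T : ℝ}
    (hW : ‖W‖ ≤ M) (hT : 0 ≤ T) (y : Fin d' → ℝ)
    (hy : ∀ a, |y a| ≤ ‖(WithLp.toLp 2 (W a) : EuclideanSpace ℝ (Fin d))‖ * T) :
    ‖(WithLp.toLp 2 y : EuclideanSpace ℝ (Fin d'))‖ ≤ M * T := by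
  have hM : 0 ≤ M := (norm_nonneg W).trans hW
  refine le_of_sq_le_sq ?_ (by positivity)
  rw [EuclideanSpace.norm_sq_eq, mul_pow]
  calc ∑ a, ‖y a‖ ^ 2
      ≤ ∑ a, ‖(WithLp.toLp 2 (W a) : EuclideanSpace ℝ (Fin d))‖ ^ 2 * T ^ 2 := by
        refine Finset.sum_le_sum fun a _ => ?_
        rw [← mul_pow]
        exact pow_le_pow_left₀ (norm_nonneg _) (hy a) 2
    _ = ‖W‖ ^ 2 * T ^ 2 := by rw [← Finset.sum_mul, frobenius_norm_sq]
    _ ≤ M ^ 2 * T ^ 2 :=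
        mul_le_mul_of_nonneg_right (pow_le_pow_left₀ (norm_nonneg _) hW 2) (sq_nonneg _)

lemma norm_mulVec_le {d d' : ℕ} (W : Matrix (Fin d') (Fin d) ℝ) {M : ℝ} (hW : ‖W‖ ≤ M)
    (x : EuclideanSpace ℝ (Fin d)) :
    ‖(WithLp.toLp 2 (Matrix.mulVec W x.ofLp) : EuclideanSpace ℝ (Fin d'))‖ ≤ M * ‖x‖ :=
  norm_le_of_abs_le_mul_row W hW (norm_nonneg x) _ fun a => by
    rw [mulVec_eq_inner]; exact abs_real_inner_le_norm _ _

/-- A layer with activation `r`. -/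
def layer {d d' : ℕ} (r : ℝ → ℝ) (W : Matrix (Fin d') (Fin d) ℝ) (x : EuclideanSpace ℝ (Fin d)) :
    EuclideanSpace ℝ (Fin d') :=
  WithLp.toLp 2 fun a => r (Matrix.mulVec W x.ofLp a)

lemma norm_layer_le {d d' : ℕ} {r : ℝ → ℝ} (hr : PosHomogeneous r) {R : ℝ≥0}
    (hL : LipschitzWith R r) (W : Matrix (Fin d') (Fin d) ℝ) {M : ℝ} (hW : ‖W‖ ≤ M)
    (x : EuclideanSpace ℝ (Fin d)) : ‖layer r W x‖ ≤ M * R * ‖x‖ := by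
  rw [mul_assoc]
  refine norm_le_of_abs_le_mul_row W hW (by positivity) _ fun a => ?_
  refine (hr.abs_le hL _).trans ?_
  rw [mulVec_eq_inner, mul_left_comm]
  exact mul_le_mul_of_nonneg_left (abs_real_inner_le_norm _ _) R.2

/-- A signed sum of outputs of a layer is dominated by that of a single normalized neuron. -/
lemma exists_neuron {d d' n : ℕ} {r : ℝ → ℝ} (hr : PosHomogeneous r)
    (W : Matrix (Fin d') (Fin d) ℝ) {M : ℝ} (hW : ‖W‖ ≤ M)
    (x : Fin n → EuclideanSpace ℝ (Fin d)) (ε : Fin n → Bool) :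
    ∃ w : EuclideanSpace ℝ (Fin d), ‖w‖ ≤ 1 ∧
      ‖∑ c, sgn (ε c) • layer r W (x c)‖ ≤ M * |∑ c, sgn (ε c) * r (inner ℝ w (x c))| := by
  have hM : 0 ≤ M := (norm_nonneg W).trans hW
  set row : Fin d' → EuclideanSpace ℝ (Fin d) := fun a => WithLp.toLp 2 (W a) with hrow
  set u : Fin d' → EuclideanSpace ℝ (Fin d) := fun a => ‖row a‖⁻¹ • row a with hu
  have hru : ∀ a, row a = ‖row a‖ • u a := fun a => by
    by_cases h : row a = 0
    · simp [h]
    · rw [hu]; simp only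
      rw [smul_smul, mul_inv_cancel₀ (norm_ne_zero_iff.2 h), one_smul]
  have hu1 : ∀ a, ‖u a‖ ≤ 1 := fun a => by
    rw [hu]; simp only
    rw [norm_smul, norm_inv, norm_norm]
    exact inv_mul_le_one
  -- Positive homogeneity pulls each row norm out of `r`, leaving one normalized neuron per output
  -- coordinate; the best of them is the witness.
  have hsum : ∑ c, sgn (ε c) • layer r W (x c)
      = WithLp.toLp 2 fun a => ‖row a‖ * ∑ c, sgn (ε c) * r (inner ℝ (u a) (x c)) := by
    ext a
    simp only [WithLp.ofLp_sum, WithLp.ofLp_smul, Finset.sum_apply, Pi.smul_apply, smul_eq_mul,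
      layer, Finset.mul_sum]
    refine Finset.sum_congr rfl fun c _ => ?_
    rw [mulVec_eq_inner]
    change sgn (ε c) * r (inner ℝ (row a) (x c)) = _
    conv_lhs => rw [hru a, real_inner_smul_left, hr _ (norm_nonneg _)]
    ring
  rcases isEmpty_or_nonempty (Fin d') with hd | hd
  · refine ⟨0, by simp, ?_⟩
    rw [hsum, EuclideanSpace.norm_eq]
    simp only [Finset.univ_eq_empty, Finset.sum_empty, Real.sqrt_zero]
    positivity
  · obtain ⟨a₀, -, ha₀⟩ := Finset.exists_max_image Finset.univ
      (fun a => |∑ c, sgn (ε c) * r (inner ℝ (u a) (x c))|) Finset.univ_nonempty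
    refine ⟨u a₀, hu1 a₀, ?_⟩
    rw [hsum]
    refine norm_le_of_abs_le_mul_row W hW (abs_nonneg _) _ fun a => ?_
    rw [abs_mul, abs_norm]
    exact mul_le_mul_of_nonneg_left (ha₀ a (Finset.mem_univ a)) (norm_nonneg _)

/-- The exponential moment `∑_ε sup_i exp (a ‖∑_c ε_c u_{i,c}‖)` of a vector-valued Rademacher
process. -/
def normExpSup {ι H : Type*} [NormedAddCommGroup H] [NormedSpace ℝ H] {n : ℕ} (a : ℝ)
    (u : ι → Fin n → H) : ℝ≥0∞ :=
  ∑ ε : Fin n → Bool, ⨆ i, ENNReal.ofReal (Real.exp (a * ‖∑ c, sgn (ε c) • u i c‖))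

/-- Cauchy–Schwarz. The map `π` lets several functionals share a vector, as required for the
auxiliary neurons of a layer. -/
lemma expSup_inner_le {ι κ H : Type*} [NormedAddCommGroup H] [InnerProductSpace ℝ H] {n : ℕ}
    {a b : ℝ} (ha : 0 ≤ a) (w : κ → H) (π : κ → ι) (hw : ∀ j, ‖w j‖ ≤ b) (u : ι → Fin n → H) :
    expSup (fun j c => a * inner ℝ (w j) (u (π j) c)) ≤ normExpSup (a * b) u := by
  refine Finset.sum_le_sum fun ε _ => iSup_le fun j => ?_
  refine le_iSup_of_le (π j) (ENNReal.ofReal_le_ofReal (Real.exp_le_exp.2 ?_))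
  have : ∑ c, sgn (ε c) * (a * inner ℝ (w j) (u (π j) c))
      = a * inner ℝ (w j) (∑ c, sgn (ε c) • u (π j) c) := by
    rw [inner_sum, Finset.mul_sum]
    refine Finset.sum_congr rfl fun c _ => ?_
    rw [real_inner_smul_right]; ring
  rw [this, mul_assoc]
  refine mul_le_mul_of_nonneg_left ?_ ha
  exact (real_inner_le_norm _ _).trans (mul_le_mul_of_nonneg_right (hw j) (norm_nonneg _))

/-- After reduction to one neuron, `exp |t| ≤ exp t + exp (-t)` produces the factor 2. Contraction
then removes `r` at the price of `R`, and the neuron, of norm at most 1, is absorbed by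
Cauchy–Schwarz. -/
lemma normExpSup_layer_le {ι : Type*} [Nonempty ι] {d d' n : ℕ} {r : ℝ → ℝ}
    (hr : PosHomogeneous r) {R : ℝ≥0} (hL : LipschitzWith R r)
    (W : ι → Matrix (Fin d') (Fin d) ℝ) {M : ℝ} (hW : ∀ i, ‖W i‖ ≤ M)
    (u : ι → Fin n → EuclideanSpace ℝ (Fin d)) {a : ℝ} (ha : 0 ≤ a) :
    normExpSup a (fun i c => layer r (W i) (u i c)) ≤ 2 * normExpSup (a * (M * R)) u := by
  have hM : 0 ≤ M := (norm_nonneg (W (Classical.arbitrary ι))).trans (hW _)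
  let J := ι × {w : EuclideanSpace ℝ (Fin d) // ‖w‖ ≤ 1}
  have : Nonempty {w : EuclideanSpace ℝ (Fin d) // ‖w‖ ≤ 1} := ⟨⟨0, by simp⟩⟩
  let x : J → Fin n → ℝ := fun j c => a * M * r (inner ℝ j.2.1 (u j.1 c))
  let y : J → Fin n → ℝ := fun j c => (a * M * R) * inner ℝ j.2.1 (u j.1 c)
  have h1 : normExpSup a (fun i c => layer r (W i) (u i c))
      ≤ expSup x + expSup (fun j c => -x j c) := by
    unfold normExpSup expSup
    rw [← Finset.sum_add_distrib]
    refine Finset.sum_le_sum fun ε _ => iSup_le fun i => ?_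
    obtain ⟨w, hw, hle⟩ := exists_neuron hr (W i) (hW i) (u i) ε
    set t := ∑ c, sgn (ε c) * r (inner ℝ w (u i c)) with ht
    have e1 : ∑ c, sgn (ε c) * x (i, ⟨w, hw⟩) c = a * M * t := by
      rw [ht, Finset.mul_sum]; exact Finset.sum_congr rfl fun c _ => by simp only [x]; ring
    have e2 : ∑ c, sgn (ε c) * -x (i, ⟨w, hw⟩) c = -(a * M * t) := by
      rw [← e1, ← Finset.sum_neg_distrib]; exact Finset.sum_congr rfl fun c _ => by ring
    have h3 : a * ‖∑ c, sgn (ε c) • layer r (W i) (u i c)‖ ≤ a * M * |t| := by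
      rw [mul_assoc]; exact mul_le_mul_of_nonneg_left hle ha
    rcases le_total 0 t with h0 | h0
    · refine le_trans ?_ (le_add_of_nonneg_right zero_le)
      refine le_iSup_of_le ((i, ⟨w, hw⟩) : J) (ENNReal.ofReal_le_ofReal (Real.exp_le_exp.2 ?_))
      rw [e1]; rwa [abs_of_nonneg h0] at h3
    · refine le_trans ?_ (le_add_of_nonneg_left zero_le)
      refine le_iSup_of_le ((i, ⟨w, hw⟩) : J) (ENNReal.ofReal_le_ofReal (Real.exp_le_exp.2 ?_))
      rw [e2]; rw [abs_of_nonpos h0] at h3; linarith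
  have haM : 0 ≤ a * M := mul_nonneg ha hM
  have c1 : ∀ j c, |x j c| ≤ |y j c| := fun j c => by
    simp only [x, y]
    rw [mul_assoc (a * M) (R : ℝ), abs_mul (a * M), abs_mul (a * M), abs_mul (R : ℝ),
      abs_of_nonneg R.coe_nonneg]
    exact mul_le_mul_of_nonneg_left (hr.abs_le hL _) (abs_nonneg _)
  have c2 : ∀ j j' c, |x j c - x j' c| ≤ |y j c - y j' c| := fun j j' c => by
    simp only [x, y]
    rw [← mul_sub, ← mul_sub, mul_assoc (a * M) (R : ℝ), abs_mul (a * M), abs_mul (a * M),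
      abs_mul (R : ℝ), abs_of_nonneg R.coe_nonneg]
    exact mul_le_mul_of_nonneg_left (hL.dist_le_mul _ _) (abs_nonneg _)
  have h4 : expSup y ≤ normExpSup (a * (M * R)) u := by
    have := expSup_inner_le (a := a * M * R) (b := 1) (mul_nonneg haM R.2)
      (fun j : J => j.2.1) (fun j => j.1) (fun j => j.2.2) u
    exact this.trans_eq (by rw [mul_one, mul_assoc a M])
  have h5 : expSup x ≤ expSup y := expSup_le_expSup x y c1 c2
  have h6 : expSup (fun j c => -x j c) ≤ expSup y :=
    expSup_le_expSup _ y (fun j c => by rw [abs_neg]; exact c1 j c)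
      (fun j j' c => by rw [← neg_sub', abs_neg]; exact c2 j j' c)
  rw [two_mul]
  exact h1.trans (add_le_add (h5.trans h4) (h6.trans h4))

lemma hiddenMap_succ (p : ℕ → ℕ) (h : ℕ) (r : Fin (h + 1) → ℝ → ℝ) (W : HiddenWeights p (h + 1))
    (x : EuclideanSpace ℝ (Fin (p 0))) :
    hiddenMap p (h + 1) r W x = layer (r (Fin.last h)) (W (Fin.last h))
      (hiddenMap p h (fun i => r i.castSucc) (fun i => W i.castSucc) x) := rfl

/-- The outermost layer is peeled first. Each layer multiplies the rate `a`, hence the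
generalization. The inputs may depend on the index so that generator outputs can be fed into a
discriminator. -/
lemma normExpSup_hiddenMap_le {ι : Type*} [Nonempty ι] {n : ℕ} (p : ℕ → ℕ) (h : ℕ)
    (r : Fin h → ℝ → ℝ) (R : Fin h → ℝ≥0) (hL : ∀ i, LipschitzWith (R i) (r i))
    (hr : ∀ i, PosHomogeneous (r i)) (M : Fin h → ℝ) (W : ι → HiddenWeights p h)
    (hW : ∀ i j, ‖W i j‖ ≤ M j) (u : ι → Fin n → EuclideanSpace ℝ (Fin (p 0)))
    {a : ℝ} (ha : 0 ≤ a) :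
    normExpSup a (fun i c => hiddenMap p h r (W i) (u i c))
      ≤ 2 ^ h * normExpSup (a * ∏ j, M j * R j) u := by
  induction h generalizing a with
  | zero => simp [hiddenMap]
  | succ h ih =>
    have hM : 0 ≤ M (Fin.last h) :=
      (norm_nonneg (W (Classical.arbitrary ι) (Fin.last h))).trans (hW _ _)
    simp only [hiddenMap_succ]
    refine (normExpSup_layer_le (hr _) (hL _) (fun i => W i (Fin.last h))
      (fun i => hW i _) _ ha).trans ?_
    have := ih (fun i => r i.castSucc) (fun i => R i.castSucc) (fun i => hL _) (fun i => hr _)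
      (fun i => M i.castSucc) (fun i j => W i j.castSucc) (fun i j => hW i _)
      (mul_nonneg ha (mul_nonneg hM (R (Fin.last h)).2))
    rw [Fin.prod_univ_castSucc, pow_succ', mul_assoc (2 : ℝ≥0∞)]
    refine (mul_le_mul_right this 2).trans (le_of_eq ?_)
    congr 3
    rw [mul_comm (∏ _, _), mul_assoc a]
    rfl

lemma norm_hiddenMap_le (p : ℕ → ℕ) (h : ℕ)
    (r : Fin h → ℝ → ℝ) (R : Fin h → ℝ≥0) (hL : ∀ i, LipschitzWith (R i) (r i))
    (hr : ∀ i, PosHomogeneous (r i)) (M : Fin h → ℝ) (W : HiddenWeights p h)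
    (hW : ∀ j, ‖W j‖ ≤ M j) (x : EuclideanSpace ℝ (Fin (p 0))) :
    ‖hiddenMap p h r W x‖ ≤ (∏ j, M j * R j) * ‖x‖ := by
  induction h with
  | zero => simp [hiddenMap]
  | succ h ih =>
    rw [hiddenMap_succ, Fin.prod_univ_castSucc, mul_comm (∏ _, _), mul_assoc]
    refine (norm_layer_le (hr _) (hL _) _ (hW _) _).trans
      (mul_le_mul_of_nonneg_left ?_ (mul_nonneg ((norm_nonneg _).trans (hW _)) (R _).2))
    exact ih (fun i => r i.castSucc) (fun i => R i.castSucc) (fun i => hL _) (fun i => hr _)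
      (fun i => M i.castSucc) (fun j => W j.castSucc) (fun j => hW _)

lemma norm_gen_le (q : ℕ → ℕ) (l d : ℕ) (s : Fin (l - 1) → ℝ → ℝ) (S : Fin (l - 1) → ℝ≥0)
    (hL : ∀ i, LipschitzWith (S i) (s i)) (hs : ∀ i, PosHomogeneous (s i))
    (N : Fin (l - 1) → ℝ) (Nl : ℝ) {θ : GenParam q l d} (hθ : θ ∈ genBall q l d N Nl)
    (z : EuclideanSpace ℝ (Fin (q 0))) :
    ‖gen q l d s θ z‖ ≤ Nl * (∏ j, N j * S j) * ‖z‖ := by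
  rw [mul_assoc]
  exact (norm_mulVec_le θ.2 hθ.2 _).trans (mul_le_mul_of_nonneg_left
    (norm_hiddenMap_le q _ s S hL hs N θ.1 hθ.1 z) ((norm_nonneg θ.2).trans hθ.2))

lemma discBall_bounds_nonneg {p : ℕ → ℕ} {k : ℕ} {M : Fin (k - 1) → ℝ} {Mk : ℝ}
    (h : (discBall p k M Mk).Nonempty) : (∀ i, 0 ≤ M i) ∧ 0 ≤ Mk := by
  obtain ⟨ω, h1, h2⟩ := h
  exact ⟨fun i => (norm_nonneg (ω.1 i)).trans (h1 i), (norm_nonneg _).trans h2⟩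

lemma genBall_bounds_nonneg {q : ℕ → ℕ} {l d : ℕ} {N : Fin (l - 1) → ℝ} {Nl : ℝ}
    (h : (genBall q l d N Nl).Nonempty) : (∀ i, 0 ≤ N i) ∧ 0 ≤ Nl := by
  obtain ⟨θ, h1, h2⟩ := h
  exact ⟨fun i => (norm_nonneg (θ.1 i)).trans (h1 i), (norm_nonneg θ.2).trans h2⟩

end Frobenius

/-! ### Continuity and separability of the parametrized classes -/

lemma continuous_hiddenMap {T : Type*} [TopologicalSpace T] (p : ℕ → ℕ) (h : ℕ)
    (r : Fin h → ℝ → ℝ) (hr : ∀ i, Continuous (r i)) {W : T → HiddenWeights p h}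
    (hW : Continuous W) {x : T → EuclideanSpace ℝ (Fin (p 0))} (hx : Continuous x) :
    Continuous fun t => hiddenMap p h r (W t) (x t) := by
  induction h with
  | zero => exact hx
  | succ h ih =>
    simp only [hiddenMap_succ]
    refine (PiLp.continuous_toLp 2 _).comp (continuous_pi fun a => (hr _).comp ?_)
    have hih : Continuous fun t => hiddenMap p h (fun i => r i.castSucc)
        (fun i => W t i.castSucc) (x t) :=
      ih _ (fun i => hr _) (continuous_pi fun i => (continuous_apply _).comp hW)
    exact (continuous_apply a).comp (Continuous.matrix_mulVec
      ((continuous_apply (Fin.last h)).comp hW) ((PiLp.continuous_ofLp 2 _).comp hih))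

lemma continuous_discLogit {T : Type*} [TopologicalSpace T] (p : ℕ → ℕ) (k : ℕ)
    (r : Fin (k - 1) → ℝ → ℝ) (hr : ∀ i, Continuous (r i)) {ω : T → DiscParam p k}
    (hω : Continuous ω) {x : T → EuclideanSpace ℝ (Fin (p 0))} (hx : Continuous x) :
    Continuous fun t => discLogit p k r (ω t) (x t) :=
  (continuous_snd.comp hω).inner (continuous_hiddenMap p (k - 1) r hr (continuous_fst.comp hω) hx)

lemma continuous_gen {T : Type*} [TopologicalSpace T] (q : ℕ → ℕ) (l d : ℕ)
    (s : Fin (l - 1) → ℝ → ℝ) (hs : ∀ i, Continuous (s i)) {θ : T → GenParam q l d}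
    (hθ : Continuous θ) {z : T → EuclideanSpace ℝ (Fin (q 0))} (hz : Continuous z) :
    Continuous fun t => gen q l d s (θ t) (z t) :=
  (PiLp.continuous_toLp 2 _).comp (Continuous.matrix_mulVec (continuous_snd.comp hθ)
    ((PiLp.continuous_ofLp 2 _).comp
      (continuous_hiddenMap q (l - 1) s hs (continuous_fst.comp hθ) hz)))

/-- Provides countable dense subsets of the parameter sets, so that suprema become measurable. -/
instance secondCountable_matrix (a b : ℕ) : SecondCountableTopology (Matrix (Fin a) (Fin b) ℝ) :=
  inferInstanceAs (SecondCountableTopology (Fin a → Fin b → ℝ))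

/-! ### Bounds for complete discriminators and generators -/

lemma abs_discLogit_le (p : ℕ → ℕ) (k : ℕ) (r : Fin (k - 1) → ℝ → ℝ) (R : Fin (k - 1) → ℝ≥0)
    (hL : ∀ i, LipschitzWith (R i) (r i)) (hr : ∀ i, PosHomogeneous (r i))
    (M : Fin (k - 1) → ℝ) (Mk : ℝ) {ω : DiscParam p k} (hω : ω ∈ discBall p k M Mk)
    (x : EuclideanSpace ℝ (Fin (p 0))) :
    |discLogit p k r ω x| ≤ Mk * (∏ i, M i * R i) * ‖x‖ := by
  rw [mul_assoc]
  exact (abs_real_inner_le_norm _ _).trans (mul_le_mul hω.2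
    (norm_hiddenMap_le p _ r R hL hr M ω.1 hω.1 x) (norm_nonneg _) ((norm_nonneg _).trans hω.2))

/-- The linear output is absorbed by Cauchy–Schwarz, so only the `k - 1` hidden layers cost a factor
2. -/
lemma expSup_discLogit_le {ι : Type*} [Nonempty ι] {n : ℕ} (p : ℕ → ℕ) (k : ℕ)
    (r : Fin (k - 1) → ℝ → ℝ) (R : Fin (k - 1) → ℝ≥0)
    (hL : ∀ i, LipschitzWith (R i) (r i)) (hr : ∀ i, PosHomogeneous (r i))
    (M : Fin (k - 1) → ℝ) (Mk : ℝ) (ω : ι → DiscParam p k) (hω : ∀ i, ω i ∈ discBall p k M Mk)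
    (u : ι → Fin n → EuclideanSpace ℝ (Fin (p 0))) {a : ℝ} (ha : 0 ≤ a) :
    expSup (fun i c => a * discLogit p k r (ω i) (u i c))
      ≤ 2 ^ (k - 1) * normExpSup (a * (Mk * ∏ i, M i * R i)) u := by
  have hMk : 0 ≤ Mk := (norm_nonneg (ω (Classical.arbitrary ι)).2).trans (hω _).2
  refine (expSup_inner_le ha (fun i => (ω i).2) id (fun i => (hω i).2)
    (fun i c => hiddenMap p (k - 1) r (ω i).1 (u i c))).trans ?_
  rw [← mul_assoc a]
  exact normExpSup_hiddenMap_le p _ r R hL hr M (fun i => (ω i).1) (fun i => (hω i).1) u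
    (mul_nonneg ha hMk)

/-- The last matrix commutes with signed sums and therefore costs only its norm, without a factor 2.
-/
lemma normExpSup_gen_le {ι : Type*} [Nonempty ι] {n : ℕ} (q : ℕ → ℕ) (l d : ℕ)
    (s : Fin (l - 1) → ℝ → ℝ) (S : Fin (l - 1) → ℝ≥0)
    (hL : ∀ i, LipschitzWith (S i) (s i)) (hs : ∀ i, PosHomogeneous (s i))
    (N : Fin (l - 1) → ℝ) (Nl : ℝ) (hNl : 0 ≤ Nl) (θ : ι → GenParam q l d)
    (hθ : ∀ i, θ i ∈ genBall q l d N Nl)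
    (u : ι → Fin n → EuclideanSpace ℝ (Fin (q 0))) {a : ℝ} (ha : 0 ≤ a) :
    normExpSup a (fun i c => gen q l d s (θ i) (u i c))
      ≤ 2 ^ (l - 1) * normExpSup (a * (Nl * ∏ j, N j * S j)) u := by
  have h1 : normExpSup a (fun i c => gen q l d s (θ i) (u i c))
      ≤ normExpSup (a * Nl) (fun i c => hiddenMap q (l - 1) s (θ i).1 (u i c)) := by
    refine Finset.sum_le_sum fun ε _ => iSup_mono fun i =>
      ENNReal.ofReal_le_ofReal (Real.exp_le_exp.2 ?_)
    rw [mul_assoc]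
    refine mul_le_mul_of_nonneg_left ?_ ha
    have : ∑ c, sgn (ε c) • gen q l d s (θ i) (u i c)
        = WithLp.toLp 2 (Matrix.mulVec (θ i).2
          (∑ c, sgn (ε c) • hiddenMap q (l - 1) s (θ i).1 (u i c)).ofLp) := by
      simp only [gen, WithLp.ofLp_sum, WithLp.ofLp_smul, Matrix.mulVec_sum, Matrix.mulVec_smul,
        WithLp.toLp_sum, WithLp.toLp_smul]
    rw [this]
    exact norm_mulVec_le _ (hθ i).2 _
  refine h1.trans ?_
  rw [← mul_assoc a]
  exact normExpSup_hiddenMap_le q _ s S hL hs N (fun i => (θ i).1) (fun i => (hθ i).1) u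
    (mul_nonneg ha hNl)

/-! ### The bounded differences inequality -/

lemma integrable_of_abs_le {α : Type*} [MeasurableSpace α] {μ : Measure α} [IsFiniteMeasure μ]
    {f : α → ℝ} (hf : Measurable f) {B : ℝ} (hB : ∀ x, |f x| ≤ B) : Integrable f μ :=
  Integrable.of_bound hf.aestronglyMeasurable B (Filter.Eventually.of_forall hB)

lemma integrable_exp_of_abs_le {α : Type*} [MeasurableSpace α] {μ : Measure α} [IsFiniteMeasure μ]
    {f : α → ℝ} (hf : Measurable f) {B : ℝ} (hB : ∀ x, |f x| ≤ B) :
    Integrable (fun x => Real.exp (f x)) μ :=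
  integrable_of_abs_le hf.exp (B := Real.exp B) fun x => by
    rw [Real.abs_exp]; exact Real.exp_le_exp.2 ((le_abs_self _).trans (hB x))

lemma abs_integral_le_of_abs_le {α : Type*} [MeasurableSpace α] {μ : Measure α}
    [IsProbabilityMeasure μ] {f : α → ℝ} {B : ℝ} (hB : ∀ x, |f x| ≤ B) : |∫ x, f x ∂μ| ≤ B := by
  have := norm_integral_le_of_norm_le_const (μ := μ) (f := f) (Filter.Eventually.of_forall hB)
  simpa using this

/-- Hoeffding's lemma on an interval of length `c` starting at the infimum of `G`. -/
lemma mgf_le_of_abs_sub_le {E : Type*} [MeasurableSpace E] (P : Measure E) [IsProbabilityMeasure P]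
    {G : E → ℝ} (hG : Measurable G) {B : ℝ} (hB : ∀ x, |G x| ≤ B) {c : ℝ}
    (hc : ∀ x y, |G x - G y| ≤ c) (t : ℝ) :
    ∫ x, Real.exp (t * (G x - ∫ y, G y ∂P)) ∂P ≤ Real.exp ((c / 2) ^ 2 * t ^ 2 / 2) := by
  have : Nonempty E := nonempty_of_isProbabilityMeasure P
  have hbdd : BddBelow (Set.range G) := ⟨-B, by rintro _ ⟨x, rfl⟩; exact (abs_le.1 (hB x)).1⟩
  have hmem : ∀ᵐ x ∂P, G x ∈ Set.Icc (⨅ y, G y) ((⨅ y, G y) + c) :=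
    Filter.Eventually.of_forall fun x => ⟨ciInf_le hbdd x, by
      have : G x - c ≤ ⨅ y, G y := le_ciInf fun y => by
        have := (abs_le.1 (hc x y)).2; linarith
      linarith⟩
  have h := (hasSubgaussianMGF_of_mem_Icc hG.aemeasurable hmem).mgf_le t
  simp only [mgf, add_sub_cancel_left] at h
  refine h.trans (le_of_eq ?_)
  push_cast
  rw [Real.norm_eq_abs, div_pow, sq_abs, div_pow]

/-- Induction on the number of coordinates: given the first one, the others are handled by induction
around the conditional mean `G`, and `G` itself oscillates by at most `c`, so Hoeffding's lemma
applies. -/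
lemma mgf_pi_le_of_boundedDifferences {E : Type*} [MeasurableSpace E] (P : Measure E)
    [IsProbabilityMeasure P] (n : ℕ) (f : (Fin n → E) → ℝ) (hf : Measurable f) {B : ℝ}
    (hB : ∀ x, |f x| ≤ B) {c : ℝ} (hc : ∀ x j e, |f x - f (Function.update x j e)| ≤ c) (t : ℝ) :
    ∫ x, Real.exp (t * (f x - ∫ y, f y ∂Measure.pi fun _ => P)) ∂(Measure.pi fun _ => P)
      ≤ Real.exp (n * (c / 2) ^ 2 * t ^ 2 / 2) := by
  induction n with
  | zero =>
    have h : ∀ x y : Fin 0 → E, f x = f y := fun x y => by rw [Subsingleton.elim x y]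
    have h2 : ∀ x, f x - ∫ y, f y ∂(Measure.pi fun _ => P) = 0 := fun x => by
      rw [integral_congr_ae (Filter.Eventually.of_forall fun y => h y x)]
      simp
    simp [h2]
  | succ n ih =>
    set ν : Measure (Fin n → E) := Measure.pi fun _ => P with hν
    set e := MeasurableEquiv.piFinSuccAbove (fun _ : Fin (n + 1) => E) 0 with he
    have hmp : MeasurePreserving e (Measure.pi fun _ => P) (P.prod ν) :=
      measurePreserving_piFinSuccAbove (fun _ : Fin (n + 1) => P) 0
    set g : E × (Fin n → E) → ℝ := fun z => f (e.symm z) with hg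
    have hgm : Measurable g := hf.comp e.symm.measurable
    have hgB : ∀ z, |g z| ≤ B := fun z => hB _
    have hes : ∀ z : E × (Fin n → E), e.symm z = Fin.cons z.1 z.2 := fun z => by
      rw [he]; simp [MeasurableEquiv.piFinSuccAbove, Fin.insertNthEquiv]
    have hge : ∀ x, f x = g (e x) := fun x => by simp [hg]
    have hg1 : ∀ x x' y, |g (x, y) - g (x', y)| ≤ c := fun x x' y => by
      have := hc (Fin.cons x y) 0 x'
      rw [Fin.update_cons_zero] at this
      simpa only [hg, hes] using this
    have hg2 : ∀ x y j a, |g (x, y) - g (x, Function.update y j a)| ≤ c := fun x y j a => by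
      have := hc (Fin.cons x y) j.succ a
      rw [← Fin.cons_update] at this
      simpa only [hg, hes] using this
    set m := ∫ y, f y ∂Measure.pi fun _ => P with hm
    have hm' : m = ∫ z, g z ∂(P.prod ν) := by
      rw [hm, ← hmp.integral_comp']
      exact integral_congr_ae (Filter.Eventually.of_forall hge)
    set G : E → ℝ := fun x => ∫ y, g (x, y) ∂ν with hG
    have hGm : Measurable G := (hgm.stronglyMeasurable.integral_prod_right').measurable
    have hGB : ∀ x, |G x| ≤ B := fun x => abs_integral_le_of_abs_le fun y => hgB _
    have hgx : ∀ x, Integrable (fun y => g (x, y)) ν := fun x =>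
      integrable_of_abs_le (hgm.comp measurable_prodMk_left) fun y => hgB _
    have hGc : ∀ x x', |G x - G x'| ≤ c := fun x x' => by
      rw [hG]; simp only
      rw [← integral_sub (hgx x) (hgx x')]
      exact abs_integral_le_of_abs_le fun y => hg1 x x' y
    have hmG : m = ∫ x, G x ∂P := by
      rw [hm', integral_prod _ (integrable_of_abs_le hgm hgB)]
    have hbound : ∀ z, |t * (g z - m)| ≤ |t| * (B + B) := fun z => by
      rw [abs_mul]
      refine mul_le_mul_of_nonneg_left ?_ (abs_nonneg t)
      refine (abs_sub _ _).trans (add_le_add (hgB z) ?_)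
      exact abs_integral_le_of_abs_le hB
    have hbound' : ∀ x, |t * (G x - m)| ≤ |t| * (B + B) := fun x => by
      rw [abs_mul]
      refine mul_le_mul_of_nonneg_left ?_ (abs_nonneg t)
      refine (abs_sub _ _).trans (add_le_add (hGB x) ?_)
      exact abs_integral_le_of_abs_le hB
    have hI : Integrable (fun z => Real.exp (t * (g z - m))) (P.prod ν) :=
      integrable_exp_of_abs_le ((hgm.sub_const m).const_mul t) hbound
    calc ∫ x, Real.exp (t * (f x - m)) ∂(Measure.pi fun _ => P)
        = ∫ z, Real.exp (t * (g z - m)) ∂(P.prod ν) := by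
          rw [← hmp.integral_comp']
          exact integral_congr_ae (Filter.Eventually.of_forall fun x => by simp only [hge])
      _ = ∫ x, ∫ y, Real.exp (t * (g (x, y) - m)) ∂ν ∂P := integral_prod _ hI
      _ ≤ ∫ x, Real.exp (t * (G x - m)) * Real.exp (n * (c / 2) ^ 2 * t ^ 2 / 2) ∂P := by
          refine integral_mono hI.integral_prod_left
            ((integrable_exp_of_abs_le ((hGm.sub_const m).const_mul t) hbound').mul_const _)
            fun x => ?_
          have e1 : ∀ y, Real.exp (t * (g (x, y) - m))
              = Real.exp (t * (G x - m)) * Real.exp (t * (g (x, y) - G x)) := fun y => by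
            rw [← Real.exp_add]; congr 1; ring
          simp only [e1]
          rw [integral_const_mul]
          refine mul_le_mul_of_nonneg_left ?_ (Real.exp_pos _).le
          exact ih (fun y => g (x, y)) (hgm.comp measurable_prodMk_left) (fun y => hgB _)
            (fun y j a => hg2 x y j a)
      _ ≤ Real.exp ((c / 2) ^ 2 * t ^ 2 / 2) * Real.exp (n * (c / 2) ^ 2 * t ^ 2 / 2) := by
          rw [integral_mul_const, hmG]
          exact mul_le_mul_of_nonneg_right (mgf_le_of_abs_sub_le P hGm hGB hGc t)
            (Real.exp_pos _).le
      _ = _ := by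
          rw [← Real.exp_add]; congr 1; push_cast; ring

lemma measure_ge_le_of_boundedDifferences {E : Type*} [MeasurableSpace E] (P : Measure E)
    [IsProbabilityMeasure P] (n : ℕ) (f : (Fin n → E) → ℝ) (hf : Measurable f) {B : ℝ}
    (hB : ∀ x, |f x| ≤ B) {c : ℝ} (hc : ∀ x j e, |f x - f (Function.update x j e)| ≤ c)
    {t : ℝ} (ht : 0 ≤ t) :
    (Measure.pi fun _ : Fin n => P).real {x | t ≤ f x - ∫ y, f y ∂Measure.pi fun _ => P}
      ≤ Real.exp (-t ^ 2 / (2 * (n * (c / 2) ^ 2))) := by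
  have hsub : HasSubgaussianMGF (fun x => f x - ∫ y, f y ∂Measure.pi fun _ => P)
      (n * (‖c‖₊ / 2) ^ 2) (Measure.pi fun _ : Fin n => P) := by
    refine ⟨fun s => ?_, fun s => ?_⟩
    · refine integrable_exp_of_abs_le ((hf.sub_const _).const_mul s) (B := |s| * (B + B))
        fun x => ?_
      rw [abs_mul]
      refine mul_le_mul_of_nonneg_left ?_ (abs_nonneg s)
      exact (abs_sub _ _).trans (add_le_add (hB x) (abs_integral_le_of_abs_le hB))
    · refine (mgf_pi_le_of_boundedDifferences P n f hf hB hc s).trans (le_of_eq ?_)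
      push_cast
      rw [Real.norm_eq_abs, div_pow, div_pow, sq_abs]
  refine (hsub.measure_ge_le ht).trans (le_of_eq ?_)
  push_cast
  rw [Real.norm_eq_abs, div_pow, div_pow, sq_abs]

/-! ### Symmetrization -/

lemma abs_ciSup_le {ι : Type*} [Nonempty ι] {y : ι → ℝ} {B : ℝ} (h : ∀ i, |y i| ≤ B) :
    |⨆ i, y i| ≤ B := by
  have hb : BddAbove (Set.range y) := ⟨B, by rintro _ ⟨i, rfl⟩; exact (abs_le.1 (h i)).2⟩
  refine abs_le.2 ⟨?_, ciSup_le fun i => (abs_le.1 (h i)).2⟩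
  exact (abs_le.1 (h (Classical.arbitrary ι))).1.trans (le_ciSup hb _)

lemma abs_ciSup_sub_ciSup_le {ι : Type*} [Nonempty ι] {y z : ι → ℝ} {B c : ℝ}
    (hy : ∀ i, |y i| ≤ B) (hz : ∀ i, |z i| ≤ B) (h : ∀ i, |y i - z i| ≤ c) :
    |(⨆ i, y i) - ⨆ i, z i| ≤ c := by
  have hb : BddAbove (Set.range y) := ⟨B, by rintro _ ⟨i, rfl⟩; exact (abs_le.1 (hy i)).2⟩
  have hb' : BddAbove (Set.range z) := ⟨B, by rintro _ ⟨i, rfl⟩; exact (abs_le.1 (hz i)).2⟩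
  have h1 : (⨆ i, y i) ≤ (⨆ i, z i) + c := ciSup_le fun i => by
    have := le_ciSup hb' i
    have := (abs_le.1 (h i)).2
    linarith
  have h2 : (⨆ i, z i) ≤ (⨆ i, y i) + c := ciSup_le fun i => by
    have := le_ciSup hb i
    have := (abs_le.1 (h i)).1
    linarith
  exact abs_le.2 ⟨by linarith, by linarith⟩

lemma abs_sum_fin_le {n : ℕ} {v : Fin n → ℝ} {B : ℝ} (h : ∀ c, |v c| ≤ B) :
    |∑ c, v c| ≤ n * B := by
  refine (Finset.abs_sum_le_sum_abs _ _).trans ?_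
  refine (Finset.sum_le_sum fun c _ => h c).trans ?_
  simp

lemma integral_symmetrization_le {E ι : Type*} [MeasurableSpace E] (P : Measure E)
    [IsProbabilityMeasure P] [Countable ι] [Nonempty ι] (n : ℕ) (F : ι → E → ℝ)
    (hF : ∀ i, Measurable (F i)) {b K : ℝ} (hb : ∀ i x, |F i x| ≤ b)
    (hK : ∀ x : Fin n → E, ∑ ε : Fin n → Bool, ⨆ i, ∑ c, sgn (ε c) * F i (x c) ≤ 2 ^ n * K) :
    ∫ x, ⨆ i, ∑ c, (∫ e, F i e ∂P - F i (x c)) ∂(Measure.pi fun _ : Fin n => P) ≤ 2 * K := by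
  set Pn : Measure (Fin n → E) := Measure.pi fun _ => P with hPn
  have hFi : ∀ i, Integrable (F i) P := fun i => integrable_of_abs_le (hF i) (hb i)
  have hFe : ∀ i (c : Fin n), ∫ y : Fin n → E, F i (y c) ∂Pn = ∫ e, F i e ∂P := fun i c =>
    integral_comp_eval (μ := fun _ : Fin n => P) (hFi i).aestronglyMeasurable
  have hFm : ∀ i (c : Fin n), Measurable fun x : Fin n → E => F i (x c) := fun i c =>
    (hF i).comp (measurable_pi_apply c)
  have hsub : ∀ i e e', |F i e - F i e'| ≤ b + b := fun i e e' =>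
    (abs_sub _ _).trans (add_le_add (hb i e) (hb i e'))
  set Ψ : (Fin n → E) × (Fin n → E) → ℝ := fun z => ⨆ i, ∑ c, (F i (z.2 c) - F i (z.1 c)) with hΨ
  have hΨm : Measurable Ψ := Measurable.iSup fun i => Finset.measurable_sum _ fun c _ =>
    ((hFm i c).comp measurable_snd).sub ((hFm i c).comp measurable_fst)
  have hΨB : ∀ z, |Ψ z| ≤ n * (b + b) := fun z =>
    abs_ciSup_le fun i => abs_sum_fin_le fun c => hsub i _ _
  have hΨi : Integrable Ψ (Pn.prod Pn) := integrable_of_abs_le hΨm hΨB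
  -- A ghost sample replaces the expectations; the supremum of integrals is at most the integral of
  -- the supremum.
  have hA : ∫ x, ⨆ i, ∑ c, (∫ e, F i e ∂P - F i (x c)) ∂Pn ≤ ∫ z, Ψ z ∂(Pn.prod Pn) := by
    rw [integral_prod _ hΨi]
    refine integral_mono ?_ hΨi.integral_prod_left fun x => ?_
    · refine integrable_of_abs_le (Measurable.iSup fun i => Finset.measurable_sum _ fun c _ =>
        (hFm i c).const_sub _) (B := n * (b + b)) fun x =>
          abs_ciSup_le fun i => abs_sum_fin_le fun c => ?_
      exact (abs_sub _ _).trans (add_le_add (abs_integral_le_of_abs_le (hb i)) (hb i _))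
    · refine ciSup_le fun i => ?_
      have hint : ∀ c ∈ Finset.univ, Integrable (fun y : Fin n → E => F i (y c) - F i (x c)) Pn :=
        fun c _ => integrable_of_abs_le ((hFm i c).sub_const _) fun y => hsub i _ _
      have e1 : ∑ c, (∫ e, F i e ∂P - F i (x c)) = ∫ y, ∑ c, (F i (y c) - F i (x c)) ∂Pn := by
        rw [integral_finsetSum _ hint]
        refine Finset.sum_congr rfl fun c _ => ?_
        rw [integral_sub (integrable_of_abs_le (hFm i c) fun y => hb i _) (integrable_const _), hFe]
        simp
      rw [e1]
      refine integral_mono (integrable_finsetSum _ hint)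
        (integrable_of_abs_le (hΨm.comp measurable_prodMk_left) fun y => hΨB _) fun y => ?_
      exact le_ciSup (f := fun i => ∑ c, (F i (y c) - F i (x c)))
        ⟨n * (b + b), by
          rintro _ ⟨i, rfl⟩
          exact (le_abs_self _).trans (abs_sum_fin_le fun c => hsub i _ _)⟩ i
  refine hA.trans ?_
  set Q : Measure (Fin n → E × E) := Measure.pi fun _ => P.prod P with hQ
  set Φ : (Fin n → Bool) → (Fin n → E × E) → ℝ :=
    fun ε w => ⨆ i, ∑ c, sgn (ε c) * (F i (w c).2 - F i (w c).1) with hΦ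
  have hFm1 : ∀ i (c : Fin n), Measurable fun w : Fin n → E × E => F i (w c).1 := fun i c =>
    (hF i).comp (measurable_fst.comp (measurable_pi_apply c))
  have hFm2 : ∀ i (c : Fin n), Measurable fun w : Fin n → E × E => F i (w c).2 := fun i c =>
    (hF i).comp (measurable_snd.comp (measurable_pi_apply c))
  have hΦm : ∀ ε, Measurable (Φ ε) := fun ε => Measurable.iSup fun i =>
    Finset.measurable_sum _ fun c _ => ((hFm2 i c).sub (hFm1 i c)).const_mul _
  have hΦB : ∀ ε w, |Φ ε w| ≤ n * (b + b) := fun ε w =>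
    abs_ciSup_le fun i => abs_sum_fin_le fun c => by
      rw [abs_mul, abs_sgn, one_mul]; exact hsub i _ _
  have hΦi : ∀ ε, Integrable (Φ ε) Q := fun ε => integrable_of_abs_le (hΦm ε) (hΦB ε)
  have hB : ∫ z, Ψ z ∂(Pn.prod Pn) = ∫ w, Φ (fun _ => true) w ∂Q := by
    rw [← (measurePreserving_arrowProdEquivProdArrow E E (Fin n) (fun _ => P)
      (fun _ => P)).integral_comp']
    refine integral_congr_ae (Filter.Eventually.of_forall fun w => ?_)
    simp only [hΨ, hΦ, sgn, if_true, one_mul]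
    rfl
  -- Swapping the two members of any pairs preserves the law, so all sign patterns have the same
  -- integral.
  have hC : ∀ ε, ∫ w, Φ (fun _ => true) w ∂Q = ∫ w, Φ ε w ∂Q := fun ε => by
    have hT : MeasurePreserving (fun (w : Fin n → E × E) c => if ε c then w c else (w c).swap)
        Q Q := by
      refine measurePreserving_pi (fun _ : Fin n => P.prod P) (fun _ => P.prod P)
        (f := fun c z => if ε c then z else z.swap) fun c => ?_
      cases ε c
      · simpa using Measure.measurePreserving_swap
      · simp only [if_true]; exact MeasurePreserving.id _
    conv_lhs => rw [← hT.map_eq]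
    rw [integral_map hT.aemeasurable (hΦm _).aestronglyMeasurable]
    refine integral_congr_ae (Filter.Eventually.of_forall fun w => ?_)
    simp only [hΦ]
    congr 1; ext i
    refine Finset.sum_congr rfl fun c _ => ?_
    cases ε c <;> simp [sgn]
  rw [hB]
  have hD : 2 ^ n * ∫ w, Φ (fun _ => true) w ∂Q = ∫ w, ∑ ε, Φ ε w ∂Q := by
    rw [integral_finsetSum _ fun ε _ => hΦi ε, ← Finset.sum_congr rfl fun ε _ => hC ε]
    simp
  -- The ghost half sees `ε`, the original half `-ε`; each contributes one Rademacher sum.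
  have hE : ∀ w, ∑ ε, Φ ε w ≤ 2 ^ n * (2 * K) := fun w => by
    have hbd : ∀ (ε : Fin n → Bool) (x : Fin n → E),
        BddAbove (Set.range fun i => ∑ c, sgn (ε c) * F i (x c)) := fun ε x =>
      ⟨n * b, by
        rintro _ ⟨i, rfl⟩
        refine (le_abs_self _).trans (abs_sum_fin_le fun c => ?_)
        rw [abs_mul, abs_sgn, one_mul]; exact hb i _⟩
    have h1 : ∀ ε, Φ ε w ≤ (⨆ i, ∑ c, sgn (ε c) * F i (w c).2)
        + ⨆ i, ∑ c, sgn (!ε c) * F i (w c).1 := fun ε => by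
      refine ciSup_le fun i => ?_
      have := le_ciSup (hbd ε fun c => (w c).2) i
      have := le_ciSup (hbd (fun c => !ε c) fun c => (w c).1) i
      simp only [sgn_not] at this ⊢
      have e : ∑ c, sgn (ε c) * (F i (w c).2 - F i (w c).1)
          = ∑ c, sgn (ε c) * F i (w c).2 + ∑ c, -sgn (ε c) * F i (w c).1 := by
        rw [← Finset.sum_add_distrib]; exact Finset.sum_congr rfl fun c _ => by ring
      rw [e]; exact add_le_add ‹_› ‹_›
    refine (Finset.sum_le_sum fun ε _ => h1 ε).trans ?_
    rw [Finset.sum_add_distrib,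
      sum_not fun ε : Fin n → Bool => ⨆ i, ∑ c, sgn (ε c) * F i (w c).1]
    have := hK fun c => (w c).1
    have := hK fun c => (w c).2
    linarith
  have hG : ∫ w, ∑ ε, Φ ε w ∂Q ≤ 2 ^ n * (2 * K) := by
    have := integral_mono (integrable_finsetSum _ fun ε _ => hΦi ε)
      (integrable_const (2 ^ n * (2 * K))) hE
    simpa using this
  rw [← hD] at hG
  exact le_of_mul_le_mul_left hG (by positivity)

/-! ### Uniform deviations -/

/-- `n` times the sum of the two one-sided maximal deviations of the empirical means from the
expectations. -/
def maxDeviation {E ι : Type*} [MeasurableSpace E] (P : Measure E) {n : ℕ} (F : ι → E → ℝ)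
    (x : Fin n → E) : ℝ :=
  (⨆ i, ∑ c, (∫ e, F i e ∂P - F i (x c))) + ⨆ i, ∑ c, (F i (x c) - ∫ e, F i e ∂P)

lemma abs_update_sum_sub_le {E : Type*} {n : ℕ} {u : E → ℝ} {c : ℝ}
    (h : ∀ e e', |u e - u e'| ≤ c) (x : Fin n → E) (j : Fin n) (e : E) :
    |∑ i, u (x i) - ∑ i, u (Function.update x j e i)| ≤ c := by
  rw [← Finset.sum_sub_distrib, Finset.sum_eq_single j]
  · exact h _ _
  · intro i _ hi; simp [Function.update_of_ne hi]
  · simp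

lemma measurable_maxDeviation {E ι : Type*} [MeasurableSpace E] (P : Measure E) [Countable ι]
    {n : ℕ} (F : ι → E → ℝ) (hF : ∀ i, Measurable (F i)) :
    Measurable (maxDeviation P F : (Fin n → E) → ℝ) := by
  have hFm : ∀ i (c : Fin n), Measurable fun x : Fin n → E => F i (x c) := fun i c =>
    (hF i).comp (measurable_pi_apply c)
  exact (Measurable.iSup fun i => Finset.measurable_sum _ fun c _ => (hFm i c).const_sub _).add
    (Measurable.iSup fun i => Finset.measurable_sum _ fun c _ => (hFm i c).sub_const _)

/-- Uniform deviation inequality for a countable class of bounded functions with Rademacher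
complexity at most `K / n`. -/
lemma measure_maxDeviation_le {E ι : Type*} [MeasurableSpace E] (P : Measure E)
    [IsProbabilityMeasure P] [Countable ι] [Nonempty ι] (n : ℕ) (hn : 1 ≤ n) (F : ι → E → ℝ)
    (hF : ∀ i, Measurable (F i)) {b K : ℝ} (hb0 : 0 ≤ b) (hb : ∀ i x, |F i x| ≤ b)
    (hK : ∀ x : Fin n → E, ∑ ε : Fin n → Bool, ⨆ i, ∑ c, sgn (ε c) * F i (x c) ≤ 2 ^ n * K)
    {δ : ℝ} (hδ : 0 < δ) (hδ1 : δ < 1) :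
    1 - δ ≤ (Measure.pi fun _ : Fin n => P).real
      {x | maxDeviation P F x ≤ 4 * K + b * √(8 * n * Real.log (1 / δ))} := by
  set Pn : Measure (Fin n → E) := Measure.pi fun _ => P with hPn
  have hm : Measurable (maxDeviation P F : (Fin n → E) → ℝ) := measurable_maxDeviation P F hF
  have hFi : ∀ i, |∫ e, F i e ∂P| ≤ b := fun i => abs_integral_le_of_abs_le (hb i)
  have b1 : ∀ (x : Fin n → E) i, |∑ c, (∫ e, F i e ∂P - F i (x c))| ≤ n * (b + b) := fun x i =>
    abs_sum_fin_le fun c => (abs_sub _ _).trans (add_le_add (hFi i) (hb i _))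
  have b2 : ∀ (x : Fin n → E) i, |∑ c, (F i (x c) - ∫ e, F i e ∂P)| ≤ n * (b + b) := fun x i =>
    abs_sum_fin_le fun c => (abs_sub _ _).trans (add_le_add (hb i _) (hFi i))
  have hB : ∀ x : Fin n → E, |maxDeviation P F x| ≤ n * (b + b) + n * (b + b) := fun x =>
    (abs_add_le _ _).trans (add_le_add (abs_ciSup_le (b1 x)) (abs_ciSup_le (b2 x)))
  -- Changing one sample point moves each of the two suprema by at most `2 * b`.
  have hd : ∀ (x : Fin n → E) j e,
      |maxDeviation P F x - maxDeviation P F (Function.update x j e)| ≤ 4 * b := fun x j e => by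
    have h1 := abs_ciSup_sub_ciSup_le (b1 x) (b1 (Function.update x j e)) (c := b + b) fun i =>
      abs_update_sum_sub_le (u := fun a => ∫ e, F i e ∂P - F i a) (fun a a' => by
        rw [sub_sub_sub_cancel_left]
        exact (abs_sub _ _).trans (add_le_add (hb i _) (hb i _))) x j e
    have h2 := abs_ciSup_sub_ciSup_le (b2 x) (b2 (Function.update x j e)) (c := b + b) fun i =>
      abs_update_sum_sub_le (u := fun a => F i a - ∫ e, F i e ∂P) (fun a a' => by
        rw [sub_sub_sub_cancel_right]
        exact (abs_sub _ _).trans (add_le_add (hb i _) (hb i _))) x j e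
    unfold maxDeviation
    rw [add_sub_add_comm]
    exact (abs_add_le _ _).trans (by linarith)
  have hK' : ∀ x : Fin n → E,
      ∑ ε : Fin n → Bool, ⨆ i, ∑ c, sgn (ε c) * -F i (x c) ≤ 2 ^ n * K := fun x => by
    rw [← sum_not]
    simpa only [sgn_not, neg_mul_neg] using hK x
  have hmean : ∫ x, maxDeviation P F x ∂Pn ≤ 4 * K := by
    have s1 := integral_symmetrization_le P n F hF hb hK
    have s2 := integral_symmetrization_le P n (fun i e => -F i e) (fun i => (hF i).neg)
      (fun i x => by rw [abs_neg]; exact hb i x) hK'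
    simp only [integral_neg, neg_sub_neg] at s2
    have hFm : ∀ i (c : Fin n), Measurable fun x : Fin n → E => F i (x c) := fun i c =>
      (hF i).comp (measurable_pi_apply c)
    unfold maxDeviation
    rw [integral_add]
    · linarith
    · exact integrable_of_abs_le (Measurable.iSup fun i => Finset.measurable_sum _ fun c _ =>
        (hFm i c).const_sub _) fun x => abs_ciSup_le (b1 x)
    · exact integrable_of_abs_le (Measurable.iSup fun i => Finset.measurable_sum _ fun c _ =>
        (hFm i c).sub_const _) fun x => abs_ciSup_le (b2 x)
  have hlog : 0 < Real.log (1 / δ) := Real.log_pos (by rw [lt_div_iff₀ hδ]; linarith)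
  -- For `b = 0` the tail exponent has denominator 0, hence value 0, and the tail bound is void; but
  -- then the deviation vanishes identically.
  rcases hb0.eq_or_lt with rfl | hbpos
  · have h0 : ∀ x : Fin n → E, maxDeviation P F x = 0 := fun x => by
      have := hB x
      simpa using this
    have hall : {x : Fin n → E | maxDeviation P F x
        ≤ 4 * K + 0 * √(8 * n * Real.log (1 / δ))} = Set.univ := by
      ext x
      simp only [h0, integral_zero] at hmean
      simp [h0, hmean]
    rw [hall, probReal_univ]
    linarith
  · set t := b * √(8 * n * Real.log (1 / δ)) with ht
    have htail := measure_ge_le_of_boundedDifferences P n (maxDeviation P F) hm hB hd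
      (t := t) (by positivity)
    have hn0 : (0 : ℝ) < n := by exact_mod_cast hn
    -- The variance proxy is 4nb², and `t` solves t² / (8nb²) = log (1/δ).
    have hexp : Real.exp (-t ^ 2 / (2 * (n * (4 * b / 2) ^ 2))) = δ := by
      rw [ht, mul_pow, Real.sq_sqrt (by positivity)]
      have : -(b ^ 2 * (8 * n * Real.log (1 / δ))) / (2 * (n * (4 * b / 2) ^ 2))
          = -Real.log (1 / δ) := by
        field_simp; ring
      rw [this, one_div, Real.log_inv, neg_neg, Real.exp_log hδ]
    rw [hexp] at htail
    have hms : MeasurableSet {x : Fin n → E | maxDeviation P F x ≤ 4 * K + t} :=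
      measurableSet_le hm measurable_const
    have hc := probReal_compl_eq_one_sub (μ := Pn) hms
    have hle : Pn.real {x : Fin n → E | maxDeviation P F x ≤ 4 * K + t}ᶜ ≤ δ := by
      refine (measureReal_mono fun x hx => ?_).trans htail
      simp only [Set.mem_compl_iff, Set.mem_ofPred_eq, not_le] at hx ⊢
      linarith
    linarith

/-! ### Uniform deviations over a continuously parametrized class -/

/-- Replace points outside the ball of radius `B` by the origin. -/
def clip {H : Type*} [NormedAddCommGroup H] (B : ℝ) (x : H) : H :=
  if ‖x‖ ≤ B then x else 0

lemma norm_clip_le {H : Type*} [NormedAddCommGroup H] {B : ℝ} (hB : 0 ≤ B) (x : H) :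
    ‖clip B x‖ ≤ B := by
  unfold clip; split_ifs with h
  · exact h
  · simpa using hB

lemma clip_of_norm_le {H : Type*} [NormedAddCommGroup H] {B : ℝ} {x : H} (h : ‖x‖ ≤ B) :
    clip B x = x := by simp [clip, h]

lemma measurable_clip {H : Type*} [NormedAddCommGroup H] [MeasurableSpace H] [BorelSpace H]
    (B : ℝ) : Measurable (clip B : H → H) :=
  Measurable.ite (measurableSet_le measurable_norm measurable_const) measurable_id measurable_const

lemma abs_comp_le {T H : Type*} [NormedAddCommGroup H] {f : T → H → ℝ} {A B C : ℝ} (hA : 0 ≤ A)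
    (hB : 0 ≤ B) (hf : ∀ t x, |f t x| ≤ A * ‖x‖) {h : ℝ → ℝ}
    (hLip : ∀ s t, |s| ≤ A * B → |t| ≤ A * B → |h s - h t| ≤ C * |s - t|) (hC : 0 ≤ C)
    (t : T) {x : H} (hx : ‖x‖ ≤ B) : |h (f t x) - h 0| ≤ C * (A * B) := by
  have hfx : |f t x| ≤ A * B := (hf t x).trans (mul_le_mul_of_nonneg_left hx hA)
  have := hLip (f t x) 0 hfx (by simpa using mul_nonneg hA hB)
  rw [sub_zero] at this
  exact this.trans (mul_le_mul_of_nonneg_left hfx hC)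

lemma abs_comp_le_add {T H : Type*} [NormedAddCommGroup H] {f : T → H → ℝ} {A B C : ℝ} (hA : 0 ≤ A)
    (hB : 0 ≤ B) (hf : ∀ t x, |f t x| ≤ A * ‖x‖) {h : ℝ → ℝ}
    (hLip : ∀ s t, |s| ≤ A * B → |t| ≤ A * B → |h s - h t| ≤ C * |s - t|) (hC : 0 ≤ C)
    (t : T) {x : H} (hx : ‖x‖ ≤ B) : |h (f t x)| ≤ |h 0| + C * (A * B) := by
  have h1 := abs_comp_le hA hB hf hLip hC t hx
  have h2 := abs_add_le (h 0) (h (f t x) - h 0)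
  rw [add_sub_cancel] at h2
  linarith

lemma deviation_bound_eq {n : ℕ} (hn : 1 ≤ n) (q k L : ℝ) :
    (4 * (q * √n * √k) + q * √(8 * n * L)) / n
      = 4 * q * √k / √n + 2 * √(2 * L) * (q / √n) := by
  have hn0 : (0 : ℝ) < n := by exact_mod_cast hn
  have hs : 0 < √(n : ℝ) := Real.sqrt_pos.2 hn0
  have hss : √(n : ℝ) * √(n : ℝ) = n := Real.mul_self_sqrt hn0.le
  have e : √(8 * n * L) = 2 * √(2 * L) * √n := by
    rw [show 8 * (n : ℝ) * L = 2 ^ 2 * n * (2 * L) by ring, Real.sqrt_mul (by positivity),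
      Real.sqrt_mul (by positivity), Real.sqrt_sq (by norm_num)]
    ring
  rw [e, div_eq_iff hn0.ne']
  field_simp
  rw [sq, hss]
  ring

/-- The countable-class bound is applied on a dense set of parameters and extended to all of them by
continuity. Differences of deviations do not see the constant `h 0`. -/
theorem exists_uniform_deviation_event {T H Ξ : Type*} [TopologicalSpace T]
    [SecondCountableTopology T] [Nonempty T] [NormedAddCommGroup H] [InnerProductSpace ℝ H]
    [MeasurableSpace H] [BorelSpace H] (P : Measure H) [IsProbabilityMeasure P]
    {A B C : ℝ} (hA : 0 ≤ A) (hB : 0 ≤ B) (hC : 0 ≤ C) (hP : ∀ᵐ x ∂P, ‖x‖ ≤ B)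
    (f : T → H → ℝ) (hfx : ∀ t, Continuous (f t)) (hft : ∀ x, Continuous fun t => f t x)
    (hf : ∀ t x, |f t x| ≤ A * ‖x‖) {n : ℕ} (hn : 1 ≤ n) (K : ℕ)
    (hexp : ∀ a : ℝ, 0 ≤ a → ∀ x : Fin n → H, expSup (fun i c => a * f i (x c))
      ≤ 2 ^ K * ∑ ε : Fin n → Bool, ENNReal.ofReal (Real.exp (a * A * ‖∑ c, sgn (ε c) • x c‖)))
    (h : ℝ → ℝ) (hh : Continuous h)
    (hLip : ∀ s t, |s| ≤ A * B → |t| ≤ A * B → |h s - h t| ≤ C * |s - t|)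
    [MeasurableSpace Ξ] (μ : Measure Ξ) [IsProbabilityMeasure μ]
    (X : Fin n → Ξ → H) (hXlaw : ∀ i, HasLaw (X i) P μ) (hXind : iIndepFun X μ)
    {δ : ℝ} (hδ : 0 < δ) (hδ1 : δ < 1) :
    ∃ S : Set Ξ, MeasurableSet S ∧ 1 - δ ≤ μ.real S ∧ ∀ ξ ∈ S, (∀ c, ‖X c ξ‖ ≤ B) ∧
      ∀ t t', (∫ x, h (f t x) ∂P - (n : ℝ)⁻¹ * ∑ c, h (f t (X c ξ)))
        - (∫ x, h (f t' x) ∂P - (n : ℝ)⁻¹ * ∑ c, h (f t' (X c ξ)))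
        ≤ 4 * (C * (A * B)) * √(3 * (K + 1)) / √n
          + 2 * √(2 * Real.log (1 / δ)) * (C * (A * B) / √n) := by
  have hn0 : (0 : ℝ) < n := by exact_mod_cast hn
  obtain ⟨s, hsc, hsd⟩ := TopologicalSpace.exists_countable_dense T
  have : Countable s := hsc.to_subtype
  have : Nonempty s := hsd.nonempty.to_subtype
  -- Clipping makes the almost sure bound on the data hold everywhere; subtracting `h 0` gives the
  -- sup bound `C * (A * B)`.
  set F : s → H → ℝ := fun i x => h (f i (clip B x)) - h 0 with hF
  have hFm : ∀ i, Measurable (F i) := fun i =>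
    ((hh.comp (hfx i)).measurable.comp (measurable_clip B)).sub_const _
  have hb : ∀ i x, |F i x| ≤ C * (A * B) := fun i x =>
    abs_comp_le hA hB hf hLip hC i.1 (norm_clip_le hB x)
  have hK : ∀ x : Fin n → H, ∑ ε : Fin n → Bool, ⨆ i, ∑ c, sgn (ε c) * F i (x c)
      ≤ 2 ^ n * (C * (A * B) * √n * √(3 * (K + 1))) := fun x =>
    rademacher_le (fun i : s => f i) A B C K hA hB hC (fun i x => hf i x)
      (fun a ha x => (Finset.sum_le_sum fun ε _ => iSup_comp_le (fun t : T =>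
        ENNReal.ofReal (Real.exp (∑ c, sgn (ε c) * (a * f t (x c))))) Subtype.val).trans
          (hexp a ha x))
      (fun t => h t - h 0) (sub_self _) (fun s t hs ht => by
        rw [sub_sub_sub_cancel_right]; exact hLip s t hs ht)
      (fun c => clip B (x c)) (fun c => norm_clip_le hB _)
  have hdev := measure_maxDeviation_le P n hn F hFm (by positivity) hb hK hδ hδ1
  set G : Set (Fin n → H) := {x | maxDeviation P F x
    ≤ 4 * (C * (A * B) * √n * √(3 * (K + 1))) + C * (A * B) * √(8 * n * Real.log (1 / δ))} with hG
  set G' : Set (Fin n → H) := {x | ∀ c, ‖x c‖ ≤ B} with hG'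
  have hGm : MeasurableSet G := measurableSet_le (measurable_maxDeviation P F hFm) measurable_const
  have hGm' : MeasurableSet G' := by
    rw [hG', Set.ofPred_forall]
    exact MeasurableSet.iInter fun c =>
      measurableSet_le (measurable_norm.comp (measurable_pi_apply c)) measurable_const
  have hae : ∀ᵐ x ∂(Measure.pi fun _ : Fin n => P), x ∈ G' := by
    refine ae_all_iff.2 fun c => ?_
    exact (measurePreserving_eval (fun _ : Fin n => P) c).quasiMeasurePreserving.ae hP
  have hXae : AEMeasurable (fun ξ c => X c ξ) μ :=
    aemeasurable_pi_iff.2 fun c => (hXlaw c).aemeasurable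
  have hmap : μ.map (fun ξ c => X c ξ) = Measure.pi fun _ : Fin n => P := by
    rw [(iIndepFun_iff_map_fun_eq_pi_map fun c => (hXlaw c).aemeasurable).1 hXind]
    congr 1; ext1 c; exact (hXlaw c).map_eq
  have hpre : μ ((fun ξ c => X c ξ) ⁻¹' (G ∩ G')) = (Measure.pi fun _ : Fin n => P) G := by
    rw [← Measure.map_apply_of_aemeasurable hXae (hGm.inter hGm'), hmap]
    refine measure_congr ?_
    filter_upwards [hae] with x hx
    exact propext (and_iff_left hx)
  -- The samples are only a.e. measurable, so a measurable subset of full measure in the preimage is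
  -- taken.
  obtain ⟨S, hSsub, hSm, hSae⟩ :=
    (hXae.nullMeasurableSet_preimage (hGm.inter hGm')).exists_measurable_subset_ae_eq
  refine ⟨S, hSm, ?_, fun ξ hξ => ⟨(hSsub hξ).2, ?_⟩⟩
  · rw [measureReal_def, measure_congr hSae, hpre]; exact hdev
  have hx : ∀ c, ‖X c ξ‖ ≤ B := (hSsub hξ).2
  have hxG : maxDeviation P F (fun c => X c ξ) ≤ _ := (hSsub hξ).1
  have hint : ∀ t, Integrable (fun x => h (f t x)) P := fun t =>
    Integrable.of_bound (hh.comp (hfx t)).aestronglyMeasurable (|h 0| + C * (A * B)) (by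
      filter_upwards [hP] with x hx using abs_comp_le_add hA hB hf hLip hC t hx)
  have hFint : ∀ i : s, ∫ x, F i x ∂P = ∫ x, h (f i x) ∂P - h 0 := fun i => by
    have : ∫ x, F i x ∂P = ∫ x, (h (f i x) - h 0) ∂P := by
      refine integral_congr_ae ?_
      filter_upwards [hP] with x hx
      simp only [hF, clip_of_norm_le hx]
    rw [this, integral_sub (hint _) (integrable_const _)]
    simp
  set J : T → ℝ := fun t => ∫ x, h (f t x) ∂P - (n : ℝ)⁻¹ * ∑ c, h (f t (X c ξ)) with hJ
  have hJc : Continuous J := by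
    refine Continuous.sub ?_ (continuous_const.mul (continuous_finsetSum _ fun c _ =>
      hh.comp (hft _)))
    refine continuous_of_dominated (fun t => (hint t).aestronglyMeasurable) (fun t => ?_)
      (integrable_const (|h 0| + C * (A * B)))
      (Filter.Eventually.of_forall fun x => hh.comp (hft x))
    filter_upwards [hP] with x hx using abs_comp_le_add hA hB hf hLip hC t hx
  have hsumJ : ∀ i : s, ∑ c, (∫ x, F i x ∂P - F i (X c ξ)) = n * J i := fun i => by
    have : ∀ c, ∫ x, F i x ∂P - F i (X c ξ) = ∫ x, h (f i x) ∂P - h (f i (X c ξ)) := fun c => by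
      rw [hFint]; simp only [hF, clip_of_norm_le (hx c)]; ring
    simp only [this, Finset.sum_sub_distrib, Finset.sum_const, Finset.card_univ, Fintype.card_fin,
      nsmul_eq_mul, hJ]
    field_simp
  have hFb : ∀ i, |∫ e, F i e ∂P| ≤ C * (A * B) := fun i => abs_integral_le_of_abs_le (hb i)
  have key : ∀ i j : s, J i - J j ≤ 4 * (C * (A * B)) * √(3 * (K + 1)) / √n
      + 2 * √(2 * Real.log (1 / δ)) * (C * (A * B) / √n) := fun i j => by
    rw [← deviation_bound_eq hn, le_div_iff₀ hn0]
    refine le_trans ?_ hxG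
    have h1 : n * J i ≤ ⨆ i, ∑ c, (∫ x, F i x ∂P - F i (X c ξ)) := by
      rw [← hsumJ i]
      refine le_ciSup (f := fun i => ∑ c, (∫ x, F i x ∂P - F i (X c ξ)))
        ⟨n * (C * (A * B) + C * (A * B)), ?_⟩ i
      rintro _ ⟨i, rfl⟩
      exact (le_abs_self _).trans (abs_sum_fin_le fun c =>
        (abs_sub _ _).trans (add_le_add (hFb i) (hb i _)))
    have h2 : -(n * J j) ≤ ⨆ i, ∑ c, (F i (X c ξ) - ∫ x, F i x ∂P) := by
      rw [← hsumJ j, ← Finset.sum_neg_distrib]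
      simp only [neg_sub]
      refine le_ciSup (f := fun i => ∑ c, (F i (X c ξ) - ∫ x, F i x ∂P))
        ⟨n * (C * (A * B) + C * (A * B)), ?_⟩ j
      rintro _ ⟨i, rfl⟩
      exact (le_abs_self _).trans (abs_sum_fin_le fun c =>
        (abs_sub _ _).trans (add_le_add (hb i _) (hFb i)))
    unfold maxDeviation
    linarith
  exact isClosed_property2 (p := fun t t' => J t - J t' ≤ _) hsd.denseRange_val
    (isClosed_le ((hJc.comp continuous_fst).sub (hJc.comp continuous_snd)) continuous_const)
    key

/-! ### From uniform deviations to the estimation error -/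

/-- Here `a`, `a'` are the population and empirical objectives at the minimizer, `b`, `b'` those at
a competitor. Supremum over `i` and `j` separately leaves only one-sided deviations. -/
lemma ciSup_sub_le_of_deviation {S : Type*} [Nonempty S] {a a' b b' : S → ℝ} {β D : ℝ}
    (ha' : ∀ i, a' i ≤ D) (hb : ∀ i, b i ≤ D)
    (hdev : ∀ i j, (a i - a' i) - (b j - b' j) ≤ β) (hmin : ⨆ i, a' i ≤ ⨆ i, b' i) :
    (⨆ i, a i) - ⨆ i, b i ≤ β := by
  have hbd : ∀ {u : S → ℝ}, (∀ i, u i ≤ D) → BddAbove (Set.range u) := fun h =>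
    ⟨D, by rintro _ ⟨i, rfl⟩; exact h i⟩
  have h1 : ∀ j, (⨆ i, a i) ≤ β + (⨆ i, a' i) + (⨆ i, b i) - b' j := fun j =>
    ciSup_le fun i => by
      have := hdev i j
      have := le_ciSup (hbd ha') i
      have := le_ciSup (hbd hb) j
      linarith
  have h2 : (⨆ j, b' j) ≤ β + (⨆ i, a' i) + (⨆ i, b i) - ⨆ i, a i := ciSup_le fun j => by
    have := h1 j; linarith
  linarith

/-- Measurable singletons make every real function integrable against a Dirac mass, so `u` is
arbitrary. -/
lemma integral_empirical {E : Type*} [MeasurableSpace E] [MeasurableSingletonClass E] {n : ℕ}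
    (x : Fin n → E) (u : E → ℝ) : ∫ e, u e ∂(empirical x) = (n : ℝ)⁻¹ * ∑ c, u (x c) := by
  unfold empirical
  rw [integral_smul_measure, integral_finsetSum_measure fun c _ => integrable_dirac (by simp)]
  simp [integral_dirac]

/-- Common form of both parts: the loss enters only through its Lipschitz constants in the logit, on
the ranges [-Qx, Qx] and [-Qz, Qz] that the networks reach. -/
theorem estimationErrorBound_of_lipschitz
    (k : ℕ) (hk : 1 ≤ k) (p : ℕ → ℕ) (r : Fin (k - 1) → ℝ → ℝ) (R : Fin (k - 1) → ℝ≥0)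
    (hrLip : ∀ i, LipschitzWith (R i) (r i)) (hrHom : ∀ i, PosHomogeneous (r i))
    (M : Fin (k - 1) → ℝ) (Mk : ℝ)
    (Ω : Set (DiscParam p k)) (hΩne : Ω.Nonempty) (hΩ : Ω ⊆ discBall p k M Mk)
    (l : ℕ) (hl : 1 ≤ l) (q : ℕ → ℕ) (s : Fin (l - 1) → ℝ → ℝ) (S : Fin (l - 1) → ℝ≥0)
    (hsLip : ∀ j, LipschitzWith (S j) (s j)) (hsHom : ∀ j, PosHomogeneous (s j))
    (N : Fin (l - 1) → ℝ) (Nl : ℝ)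
    (Θ : Set (GenParam q l (p 0))) (hΘne : Θ.Nonempty) (hΘ : Θ ⊆ genBall q l (p 0) N Nl)
    (Pr : Measure (EuclideanSpace ℝ (Fin (p 0)))) [IsProbabilityMeasure Pr]
    (PZ : Measure (EuclideanSpace ℝ (Fin (q 0)))) [IsProbabilityMeasure PZ]
    (Bx Bz : ℝ) (hBx : ∀ᵐ x ∂Pr, ‖x‖ ≤ Bx) (hBz : ∀ᵐ z ∂PZ, ‖z‖ ≤ Bz)
    {Ξ : Type*} [MeasurableSpace Ξ] (μ : Measure Ξ) [IsProbabilityMeasure μ]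
    (n m : ℕ) (hn : 1 ≤ n) (hm : 1 ≤ m)
    (X : Fin n → Ξ → EuclideanSpace ℝ (Fin (p 0))) (hXlaw : ∀ i, HasLaw (X i) Pr μ)
    (hXind : iIndepFun X μ)
    (Z : Fin m → Ξ → EuclideanSpace ℝ (Fin (q 0))) (hZlaw : ∀ j, HasLaw (Z j) PZ μ)
    (hZind : iIndepFun Z μ)
    (δ : ℝ) (hδ : 0 < δ) (hδ1 : δ < 1)
    (Qx Qz : ℝ) (hQx : Qx = Mk * (∏ i, M i * R i) * Bx)
    (hQz : Qz = (Mk * ∏ i, M i * R i) * (Nl * ∏ j, N j * S j) * Bz)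
    (ℓ : CPELoss) (Cφ Cψ : ℝ) (hCφ : 0 ≤ Cφ) (hCψ : 0 ≤ Cψ)
    (hφc : Continuous fun t => -ℓ 1 (Real.sigmoid t))
    (hψc : Continuous fun t => -ℓ 0 (Real.sigmoid t))
    (hφ : ∀ s t, |s| ≤ Qx → |t| ≤ Qx →
      |-ℓ 1 (Real.sigmoid s) - -ℓ 1 (Real.sigmoid t)| ≤ Cφ * |s - t|)
    (hψ : ∀ s t, |s| ≤ Qz → |t| ≤ Qz →
      |-ℓ 0 (Real.sigmoid s) - -ℓ 0 (Real.sigmoid t)| ≤ Cψ * |s - t|) :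
    EstimationErrorBound ℓ (disc p k r) Ω (gen q l (p 0) s) Θ Pr PZ μ X Z δ
      (4 * Cφ * Qx * √(3 * k) / √n + 4 * Cψ * Qz * √(3 * ((k : ℝ) + l - 1)) / √m
        + 2 * √(2 * Real.log (1 / δ)) * (Cφ * Qx / √n + Cψ * Qz / √m)) := by
  obtain ⟨hM, hMk⟩ := discBall_bounds_nonneg (hΩne.mono hΩ)
  obtain ⟨hN, hNl⟩ := genBall_bounds_nonneg (hΘne.mono hΘ)
  have hBx0 : 0 ≤ Bx := by
    obtain ⟨x, hx⟩ := hBx.exists; exact (norm_nonneg x).trans hx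
  have hBz0 : 0 ≤ Bz := by
    obtain ⟨x, hx⟩ := hBz.exists; exact (norm_nonneg x).trans hx
  set Ax : ℝ := Mk * ∏ i, M i * R i with hAx
  set Ag : ℝ := Nl * ∏ j, N j * S j with hAg
  have hAx0 : 0 ≤ Ax :=
    mul_nonneg hMk (Finset.prod_nonneg fun i _ => mul_nonneg (hM i) (R i).coe_nonneg)
  have hAg0 : 0 ≤ Ag :=
    mul_nonneg hNl (Finset.prod_nonneg fun i _ => mul_nonneg (hN i) (S i).coe_nonneg)
  subst hQx hQz
  have := hΩne.to_subtype
  have := hΘne.to_subtype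
  have hrc := fun i => (hrLip i).continuous
  have hsc := fun i => (hsLip i).continuous
  set φ : ℝ → ℝ := fun t => -ℓ 1 (Real.sigmoid t)
  set ψ : ℝ → ℝ := fun t => -ℓ 0 (Real.sigmoid t)
  let f : Ω → EuclideanSpace ℝ (Fin (p 0)) → ℝ := fun ω x => discLogit p k r ω x
  let g : Ω × Θ → EuclideanSpace ℝ (Fin (q 0)) → ℝ := fun t z =>
    discLogit p k r t.1 (gen q l (p 0) s t.2 z)
  have hf : ∀ t x, |f t x| ≤ Ax * ‖x‖ := fun ω x =>
    abs_discLogit_le p k r R hrLip hrHom M Mk (hΩ ω.2) x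
  have hg : ∀ t z, |g t z| ≤ Ax * Ag * ‖z‖ := fun t z => by
    refine (abs_discLogit_le p k r R hrLip hrHom M Mk (hΩ t.1.2) _).trans ?_
    rw [mul_assoc Ax]
    exact mul_le_mul_of_nonneg_left (norm_gen_le q l (p 0) s S hsLip hsHom N Nl (hΘ t.2.2) z) hAx0
  have hgz : ∀ t, Continuous (g t) := fun t =>
    continuous_discLogit p k r hrc continuous_const
      (continuous_gen q l (p 0) s hsc continuous_const continuous_id)
  have hfx : ∀ t, Continuous (f t) := fun t =>
    continuous_discLogit p k r hrc continuous_const continuous_id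
  obtain ⟨S₁, hS₁m, hS₁, hdev₁⟩ := exists_uniform_deviation_event Pr hAx0 hBx0 hCφ hBx f hfx
    (fun x => continuous_discLogit p k r hrc continuous_subtype_val continuous_const) hf hn (k - 1)
    (fun a ha x => by
      refine (expSup_discLogit_le p k r R hrLip hrHom M Mk (fun ω : Ω => ω.1)
        (fun ω => hΩ ω.2) (fun _ => x) ha).trans (le_of_eq ?_)
      simp only [normExpSup, ciSup_const]
      rfl)
    φ hφc hφ μ X hXlaw hXind hδ hδ1
  obtain ⟨S₂, hS₂m, hS₂, hdev₂⟩ := exists_uniform_deviation_event PZ (mul_nonneg hAx0 hAg0) hBz0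
    hCψ hBz g hgz
    (fun x => continuous_discLogit p k r hrc (continuous_subtype_val.comp continuous_fst)
      (continuous_gen q l (p 0) s hsc (continuous_subtype_val.comp continuous_snd)
        continuous_const)) hg hm (k - 1 + (l - 1))
    (fun a ha x => by
      refine (expSup_discLogit_le p k r R hrLip hrHom M Mk (fun t : Ω × Θ => t.1.1)
        (fun t => hΩ t.1.2) (fun t c => gen q l (p 0) s t.2 (x c)) ha).trans ?_
      rw [pow_add, mul_assoc]
      refine mul_le_mul_right ((normExpSup_gen_le q l (p 0) s S hsLip hsHom N Nl hNl
        (fun t : Ω × Θ => t.2.1) (fun t => hΘ t.2.2) (fun _ => x)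
        (mul_nonneg ha hAx0)).trans (le_of_eq ?_)) _
      simp only [normExpSup, ciSup_const]
      rw [mul_assoc a Ax])
    ψ hψc hψ μ Z hZlaw hZind hδ hδ1
  have hkcast : ((k - 1 : ℕ) : ℝ) + 1 = k := by rw [Nat.cast_sub hk]; simp
  have hklcast : ((k - 1 + (l - 1) : ℕ) : ℝ) + 1 = (k : ℝ) + l - 1 := by
    push_cast [Nat.cast_sub hk, Nat.cast_sub hl]; ring
  rw [hkcast] at hdev₁
  rw [hklcast] at hdev₂
  refine ⟨S₁ ∩ S₂, hS₁m.inter hS₂m, ?_, ?_⟩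
  · have h1 := probReal_compl_eq_one_sub (μ := μ) hS₁m
    have h2 := probReal_compl_eq_one_sub (μ := μ) hS₂m
    have h3 := probReal_compl_eq_one_sub (μ := μ) (hS₁m.inter hS₂m)
    rw [Set.compl_inter] at h3
    have h4 := measureReal_union_le (μ := μ) S₁ᶜ S₂ᶜ
    linarith
  rintro ξ ⟨hξ₁, hξ₂⟩ θ₀ hθ₀ hmin
  obtain ⟨hXb, hd₁⟩ := hdev₁ ξ hξ₁
  obtain ⟨hZb, hd₂⟩ := hdev₂ ξ hξ₂
  have hpop : ∀ (θ : Θ), lossDiv ℓ (disc p k r) Ω Pr (PZ.map (gen q l (p 0) s θ))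
      = (⨆ ω : Ω, ((∫ x, φ (f ω x) ∂Pr) + ∫ z, ψ (g (ω, θ) z) ∂PZ))
        - (-ℓ 1 (1 / 2)) - (-ℓ 0 (1 / 2)) := fun θ => by
    unfold lossDiv
    congr 3; ext ω; congr 1
    exact integral_map
      (continuous_gen q l (p 0) s hsc continuous_const continuous_id).aemeasurable
      (hψc.comp (hfx ω)).aestronglyMeasurable
  have hemp : ∀ (θ : Θ), lossDiv ℓ (disc p k r) Ω (empirical fun i => X i ξ)
        (empirical fun j => gen q l (p 0) s θ (Z j ξ))
      = (⨆ ω : Ω, ((n : ℝ)⁻¹ * ∑ c, φ (f ω (X c ξ)) + (m : ℝ)⁻¹ * ∑ c, ψ (g (ω, θ) (Z c ξ))))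
        - (-ℓ 1 (1 / 2)) - (-ℓ 0 (1 / 2)) := fun θ => by
    unfold lossDiv
    congr 3; ext ω; congr 1 <;> exact integral_empirical _ _
  have hmean : ∀ {n : ℕ} {v : Fin n → ℝ} {D : ℝ}, 1 ≤ n → (∀ c, |v c| ≤ D) →
      (n : ℝ)⁻¹ * ∑ c, v c ≤ D := fun {n v D} hn hv => by
    have hn0 : (0 : ℝ) < n := by exact_mod_cast hn
    rw [inv_mul_le_iff₀ hn0]
    exact (le_abs_self _).trans (abs_sum_fin_le hv)
  have hint : ∀ {H : Type} [MeasurableSpace H] {P : Measure H} [IsProbabilityMeasure P]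
      {v : H → ℝ} {D : ℝ}, (∀ᵐ x ∂P, |v x| ≤ D) → ∫ x, v x ∂P ≤ D := fun {H _ P _ v D} hv => by
    have := norm_integral_le_of_norm_le_const (μ := P) (f := v) hv
    exact (le_abs_self _).trans (by simpa using this)
  -- The infimum need not be attained; it suffices to compare with each competitor `θ`.
  rw [sub_le_comm]
  refine le_ciInf fun θ => ?_
  rw [sub_le_comm, hpop θ, hpop ⟨θ₀, hθ₀⟩, sub_sub_sub_cancel_right, sub_sub_sub_cancel_right]
  have hmin' := hmin θ.2
  simp only [Set.mem_ofPred_eq] at hmin'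
  rw [hemp θ, hemp ⟨θ₀, hθ₀⟩, sub_le_sub_iff_right, sub_le_sub_iff_right] at hmin'
  have hbφ : ∀ ω x, ‖x‖ ≤ Bx → |φ (f ω x)| ≤ |φ 0| + Cφ * (Ax * Bx) := fun ω x hx =>
    abs_comp_le_add hAx0 hBx0 hf hφ hCφ ω hx
  have hbψ : ∀ t z, ‖z‖ ≤ Bz → |ψ (g t z)| ≤ |ψ 0| + Cψ * (Ax * Ag * Bz) := fun t z hz =>
    abs_comp_le_add (mul_nonneg hAx0 hAg0) hBz0 hg hψ hCψ t hz
  refine (ciSup_sub_le_of_deviation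
    (D := |φ 0| + Cφ * (Ax * Bx) + (|ψ 0| + Cψ * (Ax * Ag * Bz)))
    (β := 4 * (Cφ * (Ax * Bx)) * √(3 * k) / √n
        + 2 * √(2 * Real.log (1 / δ)) * (Cφ * (Ax * Bx) / √n)
      + (4 * (Cψ * (Ax * Ag * Bz)) * √(3 * ((k : ℝ) + l - 1)) / √m
        + 2 * √(2 * Real.log (1 / δ)) * (Cψ * (Ax * Ag * Bz) / √m)))
    (fun ω => add_le_add (hmean hn fun c => hbφ ω _ (hXb c)) (hmean hm fun c => hbψ _ _ (hZb c)))
    (fun ω => add_le_add (hint (hBx.mono fun x hx => hbφ ω x hx))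
      (hint (hBz.mono fun z hz => hbψ _ z hz)))
    (fun ω ω' => ?_) hmin').trans_eq ?_
  · have h1 := hd₁ ω ω'
    have h2 := hd₂ (ω, ⟨θ₀, hθ₀⟩) (ω', θ)
    linarith
  · ring

/-! ### Lipschitz constants of the losses composed with the sigmoid -/

lemma abs_sub_le_of_hasDerivAt {h h' : ℝ → ℝ} (hd : ∀ t, HasDerivAt h (h' t) t) {Q C : ℝ}
    (hC : ∀ t, |t| ≤ Q → |h' t| ≤ C) (s t : ℝ) (hs : |s| ≤ Q) (ht : |t| ≤ Q) :
    |h s - h t| ≤ C * |s - t| :=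
  (convex_Icc (-Q) Q).norm_image_sub_le_of_norm_hasDerivWithin_le
    (fun x _ => (hd x).hasDerivWithinAt) (fun x hx => hC x (abs_le.2 hx)) (abs_le.1 ht)
    (abs_le.1 hs)

lemma sigmoid_mul_one_sub_le (t : ℝ) : Real.sigmoid t * (1 - Real.sigmoid t) ≤ 1 / 4 := by
  nlinarith [sq_nonneg (Real.sigmoid t - 1 / 2)]

lemma one_sub_sigmoid_pos (t : ℝ) : 0 < 1 - Real.sigmoid t := by
  linarith [Real.sigmoid_lt_one t]

lemma abs_sigmoid_sub_le (s t : ℝ) : |Real.sigmoid s - Real.sigmoid t| ≤ 1 / 4 * |s - t| :=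
  abs_sub_le_of_hasDerivAt (Q := max |s| |t|) Real.hasDerivAt_sigmoid (fun u _ => by
    rw [abs_of_pos (mul_pos (Real.sigmoid_pos u) (one_sub_sigmoid_pos u))]
    exact sigmoid_mul_one_sub_le u) s t (le_max_left _ _) (le_max_right _ _)

lemma sigmoid_mem_Icc (t : ℝ) : Real.sigmoid t ∈ Set.Icc (0 : ℝ) 1 :=
  ⟨Real.sigmoid_nonneg t, Real.sigmoid_le_one t⟩

lemma abs_comp_sigmoid_sub_le {u : ℝ → ℝ} {L : ℝ≥0} (hu : LipschitzOnWith L u (Set.Icc 0 1))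
    (s t : ℝ) : |u (Real.sigmoid s) - u (Real.sigmoid t)| ≤ L / 4 * |s - t| := by
  have h1 := hu.dist_le_mul _ (sigmoid_mem_Icc s) _ (sigmoid_mem_Icc t)
  rw [Real.dist_eq, Real.dist_eq] at h1
  have h2 := mul_le_mul_of_nonneg_left (abs_sigmoid_sub_le s t) L.coe_nonneg
  linarith

lemma continuous_comp_sigmoid {u : ℝ → ℝ} {L : ℝ≥0} (hu : LipschitzOnWith L u (Set.Icc 0 1)) :
    Continuous fun t => u (Real.sigmoid t) :=
  hu.continuousOn.comp_continuous continuous_sigmoid sigmoid_mem_Icc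

/-! ### The α-loss as a function of the logit -/

/-- The exponent `(α - 1) / α`, with its limit `1` at `α = ∞`. -/
def alphaExponent (α : ℝ≥0∞) : ℝ := if α = ⊤ then 1 else (α.toReal - 1) / α.toReal

/-- The derivative u^(-1/α) of the negative loss times σ' = σ(1 - σ) gives one formula for all α,
the cases 1 and ∞ included. -/
lemma hasDerivAt_alphaPartialLoss_sigmoid {α : ℝ≥0∞} (hα : 0 < α) (t : ℝ) :
    HasDerivAt (fun t => -alphaPartialLoss α (Real.sigmoid t))
      (Real.sigmoid t ^ alphaExponent α * (1 - Real.sigmoid t)) t := by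
  have hσ := Real.hasDerivAt_sigmoid t
  have hpos := Real.sigmoid_pos t
  by_cases h1 : α = 1
  · subst h1
    simp only [alphaPartialLoss, alphaExponent, if_true, neg_neg, ENNReal.one_ne_top, if_false,
      ENNReal.toReal_one, sub_self, zero_div, Real.rpow_zero, one_mul]
    convert hσ.log hpos.ne' using 1
    field_simp
  by_cases h2 : α = ⊤
  · subst h2
    simp only [alphaPartialLoss, alphaExponent, if_true, ENNReal.top_ne_one, if_false,
      Real.rpow_one, neg_sub]
    exact hσ.sub_const 1
  · simp only [alphaPartialLoss, alphaExponent, h1, h2, if_false]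
    have ha : 0 < α.toReal := ENNReal.toReal_pos hα.ne' h2
    have ha1 : α.toReal - 1 ≠ 0 := fun h => h1 (by
      rw [← ENNReal.ofReal_toReal h2, sub_eq_zero.1 h, ENNReal.ofReal_one])
    have := (((hσ.rpow_const (p := (α.toReal - 1) / α.toReal) (Or.inl hpos.ne')).const_sub
      1).const_mul (α.toReal / (α.toReal - 1))).neg
    refine this.congr_deriv ?_
    rw [Real.rpow_sub_one hpos.ne']
    field_simp

lemma continuous_alphaPartialLoss_sigmoid {α : ℝ≥0∞} (hα : 0 < α) :
    Continuous fun t => -alphaPartialLoss α (Real.sigmoid t) :=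
  continuous_iff_continuousAt.2 fun t => (hasDerivAt_alphaPartialLoss_sigmoid hα t).continuousAt

/-- The function `s ↦ s ^ β (1 - s)` is maximal at `s₀ = β / (1 + β)`. -/
lemma rpow_mul_one_sub_le {s s₀ β : ℝ} (hs : 0 < s) (hs1 : s < 1) (hs₀ : 0 < s₀) (hs₀1 : s₀ < 1)
    (hβ0 : 0 ≤ β) (hβ : β * (1 - s₀) = s₀) : s ^ β * (1 - s) ≤ s₀ ^ β * (1 - s₀) := by
  have h1s₀ : 0 < 1 - s₀ := by linarith
  have h1 : (s / s₀) ^ β ≤ Real.exp (β * (s / s₀ - 1)) := by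
    rw [Real.rpow_def_of_pos (div_pos hs hs₀), mul_comm]
    exact Real.exp_le_exp.2
      (mul_le_mul_of_nonneg_left (Real.log_le_sub_one_of_pos (div_pos hs hs₀)) hβ0)
  have h2 : (1 - s) / (1 - s₀) ≤ Real.exp ((1 - s) / (1 - s₀) - 1) := by
    have := Real.add_one_le_exp ((1 - s) / (1 - s₀) - 1)
    linarith
  have h3 : (s / s₀) ^ β * ((1 - s) / (1 - s₀)) ≤ 1 := by
    refine (mul_le_mul h1 h2 (div_nonneg (by linarith) h1s₀.le) (Real.exp_pos _).le).trans ?_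
    rw [← Real.exp_add, Real.exp_le_one_iff]
    -- By the critical-point equation `hβ` the two exponents cancel exactly.
    refine le_of_eq ?_
    have : β = s₀ / (1 - s₀) := by rw [eq_div_iff h1s₀.ne', hβ]
    rw [this]
    field_simp
    ring
  rw [Real.div_rpow hs.le hs₀.le, div_mul_div_comm, div_le_one (by positivity)] at h3
  exact h3

lemma lipConst_nonneg (h : ℝ) (α : ℝ≥0∞) : 0 ≤ lipConst h α := by
  unfold lipConst
  split_ifs with h1 h2
  · exact mul_nonneg (Real.sigmoid_nonneg _) (Real.rpow_nonneg (Real.sigmoid_nonneg _) _)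
  · norm_num
  · have : 1 < α.toReal := by
      rw [← ENNReal.toReal_one]
      exact (ENNReal.toReal_lt_toReal ENNReal.one_ne_top h2).2 (not_le.1 h1)
    exact mul_nonneg (Real.rpow_nonneg (div_nonneg (by linarith) (by linarith)) _)
      (div_nonneg (by linarith) (by linarith))

/-- For α ≤ 1 the exponent is nonpositive, both factors decrease in `t`, and the worst point is
`-Q`. For finite α > 1 the maximum over all of (0, 1), at (α - 1) / (2α - 1), is used, so the
constant does not depend on `Q`. -/
lemma sigmoid_rpow_mul_le_lipConst {α : ℝ≥0∞} (hα : 0 < α) {Q t : ℝ} (ht : |t| ≤ Q) :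
    Real.sigmoid t ^ alphaExponent α * (1 - Real.sigmoid t) ≤ lipConst Q α := by
  have hpos := Real.sigmoid_pos t
  have hlt := Real.sigmoid_lt_one t
  obtain ⟨ht1, ht2⟩ := abs_le.1 ht
  unfold lipConst alphaExponent
  by_cases h2 : α = ⊤
  · subst h2
    simp only [if_true, top_le_iff, ENNReal.one_ne_top, if_false, Real.rpow_one]
    exact sigmoid_mul_one_sub_le t
  have ha : 0 < α.toReal := ENNReal.toReal_pos hα.ne' h2
  by_cases h1 : α ≤ 1
  · simp only [h1, h2, if_true, if_false]
    have ha1 : α.toReal ≤ 1 := by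
      rw [← ENNReal.toReal_one]
      exact ENNReal.toReal_mono ENNReal.one_ne_top h1
    rw [mul_comm, ← Real.sigmoid_neg]
    refine mul_le_mul (Real.sigmoid_le (by linarith)) ?_ (Real.rpow_nonneg hpos.le _)
      (Real.sigmoid_nonneg _)
    exact Real.rpow_le_rpow_of_nonpos (Real.sigmoid_pos _) (Real.sigmoid_le ht1)
      (div_nonpos_of_nonpos_of_nonneg (by linarith) ha.le)
  · simp only [h1, h2, if_false]
    have ha1 : 1 < α.toReal := by
      rw [← ENNReal.toReal_one]
      exact (ENNReal.toReal_lt_toReal ENNReal.one_ne_top h2).2 (not_le.1 h1)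
    have e : α.toReal / (2 * α.toReal - 1) = 1 - (α.toReal - 1) / (2 * α.toReal - 1) := by
      rw [eq_sub_iff_add_eq, ← add_div, div_eq_one_iff_eq (by linarith)]; ring
    rw [e]
    refine rpow_mul_one_sub_le hpos hlt (div_pos (by linarith) (by linarith))
      ((div_lt_one (by linarith)).2 (by linarith)) (div_nonneg (by linarith) ha.le) ?_
    rw [← e]
    field_simp

lemma abs_alphaPartialLoss_sub_le {α : ℝ≥0∞} (hα : 0 < α) {Q : ℝ} (s t : ℝ) (hs : |s| ≤ Q)
    (ht : |t| ≤ Q) :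
    |-alphaPartialLoss α (Real.sigmoid s) - -alphaPartialLoss α (Real.sigmoid t)|
      ≤ lipConst Q α * |s - t| :=
  abs_sub_le_of_hasDerivAt (hasDerivAt_alphaPartialLoss_sigmoid hα) (fun u hu => by
    rw [abs_of_pos (mul_pos (Real.rpow_pos_of_pos (Real.sigmoid_pos u) _) (one_sub_sigmoid_pos u))]
    exact sigmoid_rpow_mul_le_lipConst hα hu) s t hs ht

lemma alphaLoss_one (α : ℝ≥0∞) (t : ℝ) :
    alphaLoss α 1 (Real.sigmoid t) = alphaPartialLoss α (Real.sigmoid t) := by simp [alphaLoss]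

/-- Since 1 - σ(t) = σ(-t), the loss for label 0 is a reflection of that for label 1 and has the
same Lipschitz constant. -/
lemma alphaLoss_zero (α : ℝ≥0∞) (t : ℝ) :
    alphaLoss α 0 (Real.sigmoid t) = alphaPartialLoss α (Real.sigmoid (-t)) := by
  simp [alphaLoss, Real.sigmoid_neg]

end CPEGAN

end

/-! ### The two estimation error bounds -/

theorem mainTheorem6
    -- discriminator: `k` layers, widths `p`, activations `r i` that are `R i`-Lipschitz
    (k : ℕ) (hk : 1 ≤ k) (p : ℕ → ℕ) (r : Fin (k - 1) → ℝ → ℝ) (R : Fin (k - 1) → ℝ≥0)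
    (hrLip : ∀ i, LipschitzWith (R i) (r i)) (hrHom : ∀ i, CPEGAN.PosHomogeneous (r i))
    (M : Fin (k - 1) → ℝ) (Mk : ℝ)
    (Ω : Set (CPEGAN.DiscParam p k)) (hΩne : Ω.Nonempty) (hΩ : Ω ⊆ CPEGAN.discBall p k M Mk)
    -- generator: `l` layers, widths `q`, activations `s j` that are `S j`-Lipschitz
    (l : ℕ) (hl : 1 ≤ l) (q : ℕ → ℕ) (s : Fin (l - 1) → ℝ → ℝ) (S : Fin (l - 1) → ℝ≥0)
    (hsLip : ∀ j, LipschitzWith (S j) (s j)) (hsHom : ∀ j, CPEGAN.PosHomogeneous (s j))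
    (N : Fin (l - 1) → ℝ) (Nl : ℝ)
    (Θ : Set (CPEGAN.GenParam q l (p 0))) (hΘne : Θ.Nonempty)
    (hΘ : Θ ⊆ CPEGAN.genBall q l (p 0) N Nl)
    -- real data and latent noise, with bounded supports
    (Pr : Measure (EuclideanSpace ℝ (Fin (p 0)))) [IsProbabilityMeasure Pr]
    (PZ : Measure (EuclideanSpace ℝ (Fin (q 0)))) [IsProbabilityMeasure PZ]
    (Bx Bz : ℝ) (hBx : ∀ᵐ x ∂Pr, ‖x‖ ≤ Bx) (hBz : ∀ᵐ z ∂PZ, ‖z‖ ≤ Bz)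
    -- training samples
    {Ξ : Type*} [MeasurableSpace Ξ] (μ : Measure Ξ) [IsProbabilityMeasure μ]
    (n m : ℕ) (hn : 1 ≤ n) (hm : 1 ≤ m)
    (X : Fin n → Ξ → EuclideanSpace ℝ (Fin (p 0))) (hXlaw : ∀ i, HasLaw (X i) Pr μ)
    (hXind : iIndepFun X μ)
    (Z : Fin m → Ξ → EuclideanSpace ℝ (Fin (q 0))) (hZlaw : ∀ j, HasLaw (Z j) PZ μ)
    (hZind : iIndepFun Z μ)
    (δ : ℝ) (hδ : 0 < δ) (hδ1 : δ < 1)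
    (Qx Qz : ℝ) (hQx : Qx = Mk * (∏ i, M i * R i) * Bx)
    (hQz : Qz = (Mk * ∏ i, M i * R i) * (Nl * ∏ j, N j * S j) * Bz) :
    -- any CPE loss with Lipschitz `φ = -ℓ(1, ·)` and `ψ = -ℓ(0, ·)`
    (∀ (ℓ : CPEGAN.CPELoss) (Lφ Lψ : ℝ≥0),
      LipschitzOnWith Lφ (fun t => -ℓ 1 t) (Set.Icc 0 1) →
      LipschitzOnWith Lψ (fun t => -ℓ 0 t) (Set.Icc 0 1) →
      CPEGAN.EstimationErrorBound ℓ (CPEGAN.disc p k r) Ω (CPEGAN.gen q l (p 0) s) Θ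
        Pr PZ μ X Z δ
        (Lφ * Qx * √(3 * k) / √n + Lψ * Qz * √(3 * ((k : ℝ) + l - 1)) / √m
          + √(Real.log (1 / δ)) * (Lφ * Qx / √(2 * n) + Lψ * Qz / √(2 * m)))) ∧
    -- the `α`-GAN
    (∀ α : ℝ≥0∞, 0 < α →
      CPEGAN.EstimationErrorBound (CPEGAN.alphaLoss α) (CPEGAN.disc p k r) Ω
        (CPEGAN.gen q l (p 0) s) Θ Pr PZ μ X Z δ
        (4 * CPEGAN.lipConst Qx α * Qx * √(3 * k) / √n
          + 4 * CPEGAN.lipConst Qz α * Qz * √(3 * ((k : ℝ) + l - 1)) / √m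
          + 2 * √(2 * Real.log (1 / δ))
            * (CPEGAN.lipConst Qx α * Qx / √n + CPEGAN.lipConst Qz α * Qz / √m))) := by
  refine ⟨fun ℓ Lφ Lψ hφ hψ => ?_, fun α hα => ?_⟩
  -- The sigmoid is 1/4-Lipschitz, which cancels the factor 4 of the general bound; in the last term
  -- 2√2 / 4 = 1/√2.
  · have h := CPEGAN.estimationErrorBound_of_lipschitz k hk p r R hrLip hrHom M Mk Ω hΩne hΩ
      l hl q s S hsLip hsHom N Nl Θ hΘne hΘ Pr PZ Bx Bz hBx hBz μ n m hn hm X hXlaw hXind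
      Z hZlaw hZind δ hδ hδ1 Qx Qz hQx hQz ℓ (Lφ / 4) (Lψ / 4) (by positivity) (by positivity)
      (CPEGAN.continuous_comp_sigmoid hφ) (CPEGAN.continuous_comp_sigmoid hψ)
      (fun s t _ _ => CPEGAN.abs_comp_sigmoid_sub_le hφ s t)
      (fun s t _ _ => CPEGAN.abs_comp_sigmoid_sub_le hψ s t)
    convert h using 1
    rw [Real.sqrt_mul (by norm_num : (0 : ℝ) ≤ 2), Real.sqrt_mul (by norm_num : (0 : ℝ) ≤ 2),
      Real.sqrt_mul (by norm_num : (0 : ℝ) ≤ 2)]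
    have h2 : √(2 : ℝ) * √2 = 2 := Real.mul_self_sqrt (by norm_num)
    have h2' : (√(2 : ℝ))⁻¹ = √2 / 2 := by
      rw [inv_eq_iff_eq_inv, inv_div, eq_div_iff (by positivity), h2]
    simp only [div_eq_mul_inv, mul_inv, h2']
    ring
  · refine CPEGAN.estimationErrorBound_of_lipschitz k hk p r R hrLip hrHom M Mk Ω hΩne hΩ
      l hl q s S hsLip hsHom N Nl Θ hΘne hΘ Pr PZ Bx Bz hBx hBz μ n m hn hm X hXlaw hXind
      Z hZlaw hZind δ hδ hδ1 Qx Qz hQx hQz (CPEGAN.alphaLoss α) _ _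
      (CPEGAN.lipConst_nonneg _ _) (CPEGAN.lipConst_nonneg _ _) ?_ ?_ ?_ ?_
    · simpa only [CPEGAN.alphaLoss_one] using CPEGAN.continuous_alphaPartialLoss_sigmoid hα
    · simp only [CPEGAN.alphaLoss_zero]
      exact (CPEGAN.continuous_alphaPartialLoss_sigmoid hα).comp continuous_neg
    · intro s t hs ht
      simpa only [CPEGAN.alphaLoss_one] using CPEGAN.abs_alphaPartialLoss_sub_le hα s t hs ht
    · intro s t hs ht
      have h := CPEGAN.abs_alphaPartialLoss_sub_le hα (Q := Qz) (-s) (-t) (by rwa [abs_neg])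
        (by rwa [abs_neg])
      rw [← neg_sub' s t, abs_neg] at h
      simpa only [CPEGAN.alphaLoss_zero] using h
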